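/- **Setting.** Let $\mathcal F$ be the category with objects $1,2,3,\dots$ whose morphisms $n\to m$ are the finite ordered rooted binary forests with $n$ roots and $m$ leaves; $p\circ q$ is obtained by attaching the $i$th root of $p$ to the $i$th leaf of $q$, and $f\otimes f'$ is horizontal concatenation. Let $\mathcal{SF}$ be the category of symmetric forests: same objects, $\mathcal{SF}(n,m)=\mathcal F(n,m)\times S_m$, where $(p,\sigma)$ is written $\sigma\circ p$, permutations compose as usual, and $p\circ\tau=S(p,\tau)\circ\tau(p)$, where the $i$th tree of $\tau(p)$ is the $\tau(i)$th tree of $p$ and $S(p,\tau)$ sends the $a$th leaf of the $i$th tree of $\tau(p)$ to the $a$th leaf of the $\tau(i)$th tree of $p$. A small category $\mathcal C$ admits a calculus of left fractions if for every object $e$: (i) for all $p,q$ with source $e$ there are $h,k$ with $hp=kq$; (ii) if $pf=qf$ with $p,q$ of source $e$ and common target, then $gp=gq$ for some $g$. Its group of fractions at $e$ is the set of pairs $(t,s)$ of morphisms with source $e$ and common target, modulo the equivalence relation generated by $(t,s)\sim(ft,fs)$, with class $\frac ts$ and product $\frac ts\frac{t'}{s'}=\frac{ft}{f's'}$ whenever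 $fs=f't'$. Thompson's group $V$ is the group of fractions of $\mathcal{SF}$ at the object $1$. Let $\Gamma$ be a group and let $\Xi$ be a monoidal functor from $\mathcal F$ to groups (with direct product as tensor product) with $\Xi(1)=\Gamma$, so that $\Xi(n)=\Gamma^n$; equivalently, $\Xi$ is given by a group homomorphism $S=\Xi(Y):\Gamma\to\Gamma\times\Gamma$, where $Y$ is the tree with two leaves (for instance, but not necessarily, an injective one). For $\sigma\in S_n$ and $x\in\Gamma^n$ put $\mathrm{Tens}(\sigma)(x)=(x_{\sigma^{-1}(1)},\dots,x_{\sigma^{-1}(n)})$. Let $\mathscr G_\Xi=\varinjlim_t\Gamma_t$ be the inductive limit over all trees $t$ of the groups $\Gamma_t=\Gamma^n$ ($n$ the number of leaves of $t$), with transition maps $\Xi(f):\Gamma_t\to\Gamma_{ft}$, and write $\frac tx$ for the class of $x\in\Gamma_t$. The Jones action $\pi_\Xi:V\curvearrowright\mathscr G_\Xi$ by group automorphisms is given by $$\frac{\theta\circ t}{\sigma\circ s}\cdot\frac sx=\frac{t}{\mathrm{Tens}(\theta^{-1}\sigma)x}$$ for trees $t,s$ with $n$ leaves, $\theta,\sigma\in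 S_n$, $x\in\Gamma^n$. Let $\mathcal C_\Xi$ be the category with objects $1,2,3,\dots$ and $\mathcal C_\Xi(n,m)=\mathcal F(n,m)\times S_m\times\Gamma^m$, where $(p,\sigma,g)$ is written $g\circ\sigma\circ p$; the composition extends that of $\mathcal{SF}$ and the multiplication of $\Gamma^n$, with $f\circ g=\Xi(f)(g)\circ f$ for $f\in\mathcal F(n,m)$, $g\in\Gamma^n$, and $\sigma\circ g=\mathrm{Tens}(\sigma)(g)\circ\sigma$ for $\sigma\in S_n$, $g\in\Gamma^n$. **Proposition.** The category $\mathcal C_\Xi$ admits a calculus of left fractions. Its group of fractions at the object $1$ is isomorphic to the semidirect product $\mathscr G_\Xi\rtimes_{\pi_\Xi}V$. -/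

import Mathlib

open CategoryTheory
set_option linter.unusedVariables false
set_option linter.unusedSectionVars false
noncomputable section
namespace JonesForest

universe v u w

/-- A category admits a calculus of left fractions (at every object `e`). Composition is written
from left to right, `p ≫ h` being `h ∘ p`. -/
class LeftCalculus (C : Type u) [Category.{v} C] : Prop where
  /-- left Ore condition at `e` -/
  ore : ∀ {e a b : C} (p : e ⟶ a) (q : e ⟶ b), ∃ (c : C) (h : a ⟶ c) (k : b ⟶ c), p ≫ h = q ≫ k
  /-- weak left cancellation at `e` -/
  cancel : ∀ {d e a : C} (f : d ⟶ e) (p q : e ⟶ a), f ≫ p = f ≫ q →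
    ∃ (b : C) (g : a ⟶ b), p ≫ g = q ≫ g

section Fractions

variable {C : Type u} [Category.{v} C]

/-- A pair of morphisms with source `e` and common target. -/
structure PreFraction (e : C) where
  target : C
  num : e ⟶ target
  den : e ⟶ target

/-- The relation `(t, s) ∼ (f t, f s)`. -/
inductive PreFraction.Step {e : C} : PreFraction e → PreFraction e → Prop
  | mk {a b : C} (t s : e ⟶ a) (f : a ⟶ b) : Step ⟨a, t, s⟩ ⟨b, t ≫ f, s ≫ f⟩

/-- The group of fractions at `e`: pairs of morphisms with source `e` and common target, modulo the
equivalence relation generated by `(t, s) ∼ (f t, f s)`. -/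
def FractionGroup (e : C) : Type (max u v) := Quot (PreFraction.Step (e := e))

/-- The fraction `t / s`. -/
def FractionGroup.mk {e a : C} (t s : e ⟶ a) : FractionGroup e := Quot.mk _ ⟨a, t, s⟩

namespace FractionGroup

theorem mk_comp {e a b : C} (t s : e ⟶ a) (f : a ⟶ b) : mk (t ≫ f) (s ≫ f) = mk t s :=
  (Quot.sound (PreFraction.Step.mk t s f)).symm

theorem ind {e : C} {P : FractionGroup e → Prop} (h : ∀ {a : C} (t s : e ⟶ a), P (mk t s))
    (x : FractionGroup e) : P x := Quot.ind (fun y => h y.num y.den) x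

variable [LeftCalculus C]

theorem mul_wd {e a b c d : C} (t s : e ⟶ a) (t' s' : e ⟶ b) (f : a ⟶ c) (f' : b ⟶ c)
    (g : a ⟶ d) (g' : b ⟶ d) (hf : s ≫ f = t' ≫ f') (hg : s ≫ g = t' ≫ g') :
    mk (t ≫ f) (s' ≫ f') = mk (t ≫ g) (s' ≫ g') := by
  obtain ⟨x, h, k, hk⟩ := LeftCalculus.ore (s ≫ f) (s ≫ g)
  obtain ⟨y, b, hb⟩ := LeftCalculus.cancel t' (f' ≫ h) (g' ≫ k) (by
    rw [← Category.assoc, ← hf, hk, hg, Category.assoc])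
  obtain ⟨z, a, ha⟩ := LeftCalculus.cancel s (f ≫ h) (g ≫ k) (by simpa using hk)
  obtain ⟨w, m, n, hmn⟩ := LeftCalculus.ore b a
  rw [← mk_comp _ _ (h ≫ b ≫ m), ← mk_comp (t ≫ g) _ (k ≫ b ≫ m)]
  have h1 : f' ≫ h ≫ b ≫ m = g' ≫ k ≫ b ≫ m := by
    simpa using congrArg (· ≫ m) hb
  have h2 : f ≫ h ≫ b ≫ m = g ≫ k ≫ b ≫ m := by
    rw [hmn]; simpa using congrArg (· ≫ n) ha
  simp only [Category.assoc, h1, h2]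

/-- `(t / s) (t' / s') = f t / f' s'` for chosen `f`, `f'` with `f s = f' t'`. -/
def mulAux {e : C} (x y : PreFraction e) : FractionGroup e :=
  mk (x.num ≫ (LeftCalculus.ore x.den y.num).choose_spec.choose)
    (y.den ≫ (LeftCalculus.ore x.den y.num).choose_spec.choose_spec.choose)

theorem mulAux_eq {e a b c : C} (t s : e ⟶ a) (t' s' : e ⟶ b) (f : a ⟶ c) (f' : b ⟶ c)
    (h : s ≫ f = t' ≫ f') :
    mulAux ⟨a, t, s⟩ ⟨b, t', s'⟩ = mk (t ≫ f) (s' ≫ f') :=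
  mul_wd t s t' s' _ _ f f'
    (LeftCalculus.ore s t').choose_spec.choose_spec.choose_spec h

instance {e : C} : Mul (FractionGroup e) where
  mul := Quot.lift (fun x => Quot.lift (mulAux x) (by
      rintro _ _ ⟨t', s', k⟩
      obtain ⟨c, f, f', h⟩ := LeftCalculus.ore x.den (t' ≫ k)
      rw [mulAux_eq x.num x.den _ _ f f' h,
        mulAux_eq x.num x.den t' s' f (k ≫ f') (by simpa using h), Category.assoc])) (by
      rintro _ _ ⟨t, s, k⟩
      funext y
      induction y using Quot.ind with
      | mk y =>
      obtain ⟨c, f, f', h⟩ := LeftCalculus.ore (s ≫ k) y.num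
      change mulAux _ y = mulAux _ y
      rw [mulAux_eq (t ≫ k) _ y.num y.den f f' h,
        mulAux_eq t s y.num y.den (k ≫ f) f' (by simpa using h), Category.assoc])

instance {e : C} : One (FractionGroup e) := ⟨mk (𝟙 e) (𝟙 e)⟩

instance {e : C} : Inv (FractionGroup e) where
  inv := Quot.map (fun x => ⟨x.target, x.den, x.num⟩) (by
    rintro _ _ ⟨t, s, k⟩
    exact ⟨s, t, k⟩)

/-- The product formula, for any `f`, `f'` with `f s = f' t'`. -/
theorem mk_mul_mk {e a b c : C} (t s : e ⟶ a) (t' s' : e ⟶ b) (f : a ⟶ c) (f' : b ⟶ c)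
    (h : s ≫ f = t' ≫ f') : mk t s * mk t' s' = mk (t ≫ f) (s' ≫ f') :=
  mulAux_eq t s t' s' f f' h

theorem mk_mul_mk_self {e a : C} (t s r : e ⟶ a) : mk t s * mk s r = mk t r := by
  simpa using mk_mul_mk t s s r (𝟙 a) (𝟙 a) rfl

theorem mk_inv {e a : C} (t s : e ⟶ a) : (mk t s)⁻¹ = mk s t := rfl

theorem mk_self {e a : C} (t : e ⟶ a) : mk t t = 1 := by
  have h := mk_comp (𝟙 e) (𝟙 e) t
  rw [Category.id_comp] at h
  exact h

instance {e : C} : Group (FractionGroup e) where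
  mul_assoc x y z := by
    induction x using ind with | h t s =>
    induction y using ind with | h t' s' =>
    induction z using ind with | h t'' s'' =>
    obtain ⟨c, f, f', h⟩ := LeftCalculus.ore s t'
    obtain ⟨d, g, g', h'⟩ := LeftCalculus.ore (s' ≫ f') t''
    have h'' : s ≫ f ≫ g = t' ≫ f' ≫ g := by simpa using congrArg (· ≫ g) h
    rw [mk_mul_mk t s t' s' f f' h, mk_mul_mk _ _ t'' s'' g g' h',
      mk_mul_mk t' s' t'' s'' (f' ≫ g) g' (by simpa using h'),
      mk_mul_mk t s _ _ (f ≫ g) (𝟙 _) (by simpa using h'')]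
    simp
  one_mul x := by
    induction x using ind with | h t s =>
    rw [← mk_self t, mk_mul_mk_self]
  mul_one x := by
    induction x using ind with | h t s =>
    rw [← mk_self s, mk_mul_mk_self]
  inv_mul_cancel x := by
    induction x using ind with | h t s =>
    rw [mk_inv, mk_mul_mk_self, mk_self]

end FractionGroup
end Fractions

section Limit

variable {C : Type u} [Category.{v} C]

/-- A pair `(t, x)` with `t` a morphism from `e` to some `b` and `x ∈ Φ(b)`. -/
structure PreLimit (Φ : C ⥤ GrpCat.{w}) (e : C) where
  target : C
  path : e ⟶ target
  val : Φ.obj target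

/-- The relation `(t, x) ∼ (f t, Φ(f) x)`. -/
inductive PreLimit.Step {Φ : C ⥤ GrpCat.{w}} {e : C} : PreLimit Φ e → PreLimit Φ e → Prop
  | mk {a b : C} (t : e ⟶ a) (x : Φ.obj a) (f : a ⟶ b) :
      Step ⟨a, t, x⟩ ⟨b, t ≫ f, (Φ.map f).hom x⟩

/-- The inductive limit `lim_{t, Φ} X_t` over the morphisms `t` with source `e`, where `X_t = Φ(b)`
for `t : e ⟶ b`, with transition maps `Φ(f) : X_t → X_{ft}`. -/
def JonesLimit (Φ : C ⥤ GrpCat.{w}) (e : C) : Type (max u v w) :=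
  Quot (PreLimit.Step (Φ := Φ) (e := e))

namespace JonesLimit

variable {Φ : C ⥤ GrpCat.{w}} {e : C}

variable (Φ) in
/-- The fraction `t / x`. -/
def mk {a : C} (t : e ⟶ a) (x : Φ.obj a) : JonesLimit Φ e := Quot.mk _ ⟨a, t, x⟩

theorem mk_comp {a b : C} (t : e ⟶ a) (x : Φ.obj a) (f : a ⟶ b) :
    mk Φ (t ≫ f) ((Φ.map f).hom x) = mk Φ t x :=
  (Quot.sound (PreLimit.Step.mk t x f)).symm

theorem ind {P : JonesLimit Φ e → Prop}
    (h : ∀ {a : C} (t : e ⟶ a) (x : Φ.obj a), P (mk Φ t x)) (x : JonesLimit Φ e) : P x :=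
  Quot.ind (fun y => h y.path y.val) x

theorem map_comp_apply {a b c : C} (f : a ⟶ b) (g : b ⟶ c) (x : Φ.obj a) :
    (Φ.map (f ≫ g)).hom x = (Φ.map g).hom ((Φ.map f).hom x) := by
  rw [Φ.map_comp]; rfl

theorem map_id_apply {a : C} (x : Φ.obj a) : (Φ.map (𝟙 a)).hom x = x := by
  rw [Φ.map_id]; rfl

variable [LeftCalculus C]

theorem mk_eq_iff {a b : C} (t : e ⟶ a) (x : Φ.obj a) (s : e ⟶ b) (y : Φ.obj b) :
    mk Φ t x = mk Φ s y ↔ ∃ (c : C) (p : a ⟶ c) (q : b ⟶ c),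
      t ≫ p = s ≫ q ∧ (Φ.map p).hom x = (Φ.map q).hom y := by
  constructor
  · intro h
    have key : ∀ X Y : PreLimit Φ e, Relation.EqvGen PreLimit.Step X Y →
        ∃ (c : C) (p : X.target ⟶ c) (q : Y.target ⟶ c),
          X.path ≫ p = Y.path ≫ q ∧ (Φ.map p).hom X.val = (Φ.map q).hom Y.val := by
      intro X Y hXY
      induction hXY with
      | rel X Y h =>
        obtain ⟨t, x, f⟩ := h
        exact ⟨_, f, 𝟙 _, by simp, by simp⟩
      | refl X => exact ⟨_, 𝟙 _, 𝟙 _, rfl, rfl⟩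
      | symm X Y _ ih =>
        obtain ⟨c, p, q, h1, h2⟩ := ih
        exact ⟨c, q, p, h1.symm, h2.symm⟩
      | trans X Y Z _ _ ih1 ih2 =>
        obtain ⟨c, p, q, h1, h2⟩ := ih1
        obtain ⟨d, p', q', h1', h2'⟩ := ih2
        obtain ⟨m, f, g, hfg⟩ := LeftCalculus.ore (Y.path ≫ q) (Y.path ≫ p')
        obtain ⟨n, k, hk⟩ := LeftCalculus.cancel Y.path (q ≫ f) (p' ≫ g) (by simpa using hfg)
        refine ⟨n, p ≫ f ≫ k, q' ≫ g ≫ k, ?_, ?_⟩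
        · rw [← Category.assoc, h1, ← Category.assoc Z.path, ← h1']
          simpa using congrArg (Y.path ≫ ·) hk
        · rw [map_comp_apply, h2, map_comp_apply q', ← h2', ← map_comp_apply, ← map_comp_apply]
          rw [← Category.assoc q, hk, Category.assoc]
    exact key _ _ (Quot.eqvGen_exact h)
  · rintro ⟨c, p, q, h1, h2⟩
    rw [← mk_comp t x p, ← mk_comp s y q, h1, h2]

theorem exists_common (x y : JonesLimit Φ e) :
    ∃ (a : C) (t : e ⟶ a) (g h : Φ.obj a), x = mk Φ t g ∧ y = mk Φ t h := by
  induction x using ind with | h t g =>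
  induction y using ind with | h s h =>
  obtain ⟨c, p, q, hpq⟩ := LeftCalculus.ore t s
  exact ⟨c, t ≫ p, (Φ.map p).hom g, (Φ.map q).hom h, (mk_comp _ _ _).symm,
    by rw [hpq, mk_comp]⟩


theorem combine_wd {a b c d : C} (t : e ⟶ a) (g : Φ.obj a) (s : e ⟶ b) (h : Φ.obj b)
    (p : a ⟶ c) (q : b ⟶ c) (p' : a ⟶ d) (q' : b ⟶ d)
    (hp : t ≫ p = s ≫ q) (hp' : t ≫ p' = s ≫ q') :
    mk Φ (t ≫ p) ((Φ.map p).hom g * (Φ.map q).hom h) =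
      mk Φ (t ≫ p') ((Φ.map p').hom g * (Φ.map q').hom h) := by
  obtain ⟨x, k, l, hkl⟩ := LeftCalculus.ore (t ≫ p) (t ≫ p')
  obtain ⟨y, m, hm⟩ := LeftCalculus.cancel t (p ≫ k) (p' ≫ l) (by simpa using hkl)
  obtain ⟨z, n, hn⟩ := LeftCalculus.cancel s (q ≫ k ≫ m) (q' ≫ l ≫ m) (by
    simp only [← Category.assoc]
    rw [← hp, ← hp', hkl])
  have h1 : p ≫ k ≫ m ≫ n = p' ≫ l ≫ m ≫ n := by simpa using congrArg (· ≫ n) hm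
  have h2 : q ≫ k ≫ m ≫ n = q' ≫ l ≫ m ≫ n := by simpa using hn
  rw [← mk_comp (t ≫ p) _ (k ≫ m ≫ n), ← mk_comp (t ≫ p') _ (l ≫ m ≫ n), map_mul, map_mul]
  simp only [← map_comp_apply, Category.assoc, h1, h2]

/-- The product of `(t, g)` and `(s, h)`, computed in `Φ` of a common refinement. -/
def mulAux (X Y : PreLimit Φ e) : JonesLimit Φ e :=
  mk Φ (X.path ≫ (LeftCalculus.ore X.path Y.path).choose_spec.choose)
    ((Φ.map (LeftCalculus.ore X.path Y.path).choose_spec.choose).hom X.val *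
      (Φ.map (LeftCalculus.ore X.path Y.path).choose_spec.choose_spec.choose).hom Y.val)

theorem mulAux_eq {a b c : C} (t : e ⟶ a) (g : Φ.obj a) (s : e ⟶ b) (h : Φ.obj b)
    (p : a ⟶ c) (q : b ⟶ c) (hp : t ≫ p = s ≫ q) :
    mulAux ⟨a, t, g⟩ ⟨b, s, h⟩ = mk Φ (t ≫ p) ((Φ.map p).hom g * (Φ.map q).hom h) :=
  combine_wd t g s h _ _ p q (LeftCalculus.ore t s).choose_spec.choose_spec.choose_spec hp

instance : Mul (JonesLimit Φ e) where
  mul := Quot.lift (fun X => Quot.lift (mulAux X) (by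
      rintro _ _ ⟨s, h, k⟩
      obtain ⟨c, p, q, hp⟩ := LeftCalculus.ore X.path (s ≫ k)
      rw [mulAux_eq X.path X.val _ _ p q hp,
        mulAux_eq X.path X.val s h p (k ≫ q) (by simpa using hp), map_comp_apply])) (by
      rintro _ _ ⟨t, g, k⟩
      funext Y
      induction Y using Quot.ind with
      | mk Y =>
      obtain ⟨c, p, q, hp⟩ := LeftCalculus.ore (t ≫ k) Y.path
      change mulAux _ Y = mulAux _ Y
      rw [mulAux_eq (t ≫ k) _ Y.path Y.val p q hp,
        mulAux_eq t g Y.path Y.val (k ≫ p) q (by simpa using hp), map_comp_apply,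
        Category.assoc])

instance : One (JonesLimit Φ e) := ⟨mk Φ (𝟙 e) 1⟩

instance : Inv (JonesLimit Φ e) where
  inv := Quot.map (fun X => ⟨X.target, X.path, X.val⁻¹⟩) (by
    rintro _ _ ⟨t, g, k⟩
    have := PreLimit.Step.mk t g⁻¹ k
    rwa [map_inv] at this)

theorem mk_mul_mk {a b c : C} (t : e ⟶ a) (g : Φ.obj a) (s : e ⟶ b) (h : Φ.obj b)
    (p : a ⟶ c) (q : b ⟶ c) (hp : t ≫ p = s ≫ q) :
    mk Φ t g * mk Φ s h = mk Φ (t ≫ p) ((Φ.map p).hom g * (Φ.map q).hom h) :=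
  mulAux_eq t g s h p q hp

theorem mk_mul_mk_same {a : C} (t : e ⟶ a) (g h : Φ.obj a) :
    mk Φ t g * mk Φ t h = mk Φ t (g * h) := by
  rw [mk_mul_mk t g t h (𝟙 a) (𝟙 a) rfl, map_id_apply, map_id_apply, Category.comp_id]

theorem mk_inv {a : C} (t : e ⟶ a) (g : Φ.obj a) : (mk Φ t g)⁻¹ = mk Φ t g⁻¹ := rfl

theorem mk_one {a : C} (t : e ⟶ a) : mk Φ t 1 = 1 := by
  have h := mk_comp (𝟙 e) (1 : Φ.obj e) t
  rw [map_one, Category.id_comp] at h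
  exact h

instance : Group (JonesLimit Φ e) where
  mul_assoc x y z := by
    obtain ⟨a, t, g, h, rfl, rfl⟩ := exists_common x y
    induction z using ind with | h s k =>
    obtain ⟨c, p, q, hp⟩ := LeftCalculus.ore t s
    rw [← mk_comp t g p, ← mk_comp t h p, ← mk_comp s k q, ← hp]
    simp only [mk_mul_mk_same, mul_assoc]
  one_mul x := by
    induction x using ind with | h t g =>
    rw [← mk_one t, mk_mul_mk_same, one_mul]
  mul_one x := by
    induction x using ind with | h t g =>
    rw [← mk_one t, mk_mul_mk_same, mul_one]
  inv_mul_cancel x := by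
    induction x using ind with | h t g =>
    rw [mk_inv, mk_mul_mk_same, inv_mul_cancel, mk_one]

theorem act_wd {a b c d : C} (t s : e ⟶ a) (r : e ⟶ b) (x : Φ.obj b)
    (p : a ⟶ c) (q : b ⟶ c) (p' : a ⟶ d) (q' : b ⟶ d)
    (hp : s ≫ p = r ≫ q) (hp' : s ≫ p' = r ≫ q') :
    mk Φ (t ≫ p) ((Φ.map q).hom x) = mk Φ (t ≫ p') ((Φ.map q').hom x) := by
  obtain ⟨y, k, l, hkl⟩ := LeftCalculus.ore (s ≫ p) (s ≫ p')
  obtain ⟨z, m, hm⟩ := LeftCalculus.cancel s (p ≫ k) (p' ≫ l) (by simpa using hkl)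
  obtain ⟨w, n, hn⟩ := LeftCalculus.cancel r (q ≫ k ≫ m) (q' ≫ l ≫ m) (by
    simp only [← Category.assoc]
    rw [← hp, ← hp', hkl])
  have h1 : p ≫ k ≫ m ≫ n = p' ≫ l ≫ m ≫ n := by simpa using congrArg (· ≫ n) hm
  have h2 : q ≫ k ≫ m ≫ n = q' ≫ l ≫ m ≫ n := by simpa using hn
  rw [← mk_comp (t ≫ p) _ (k ≫ m ≫ n), ← mk_comp (t ≫ p') _ (l ≫ m ≫ n)]
  simp only [← map_comp_apply, Category.assoc, h1, h2]

/-- `(t / s) · (r / x) = p t / Φ(q) x` for chosen `p`, `q` with `p s = q r`. -/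
def actAux (v : PreFraction e) (X : PreLimit Φ e) : JonesLimit Φ e :=
  mk Φ (v.num ≫ (LeftCalculus.ore v.den X.path).choose_spec.choose)
    ((Φ.map (LeftCalculus.ore v.den X.path).choose_spec.choose_spec.choose).hom X.val)

theorem actAux_eq {a b c : C} (t s : e ⟶ a) (r : e ⟶ b) (x : Φ.obj b)
    (p : a ⟶ c) (q : b ⟶ c) (hp : s ≫ p = r ≫ q) :
    actAux ⟨a, t, s⟩ ⟨b, r, x⟩ = mk Φ (t ≫ p) ((Φ.map q).hom x) :=
  act_wd t s r x _ _ p q (LeftCalculus.ore s r).choose_spec.choose_spec.choose_spec hp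

/-- The Jones action as a map. -/
def act : FractionGroup e → JonesLimit Φ e → JonesLimit Φ e :=
  Quot.lift (fun v => Quot.lift (actAux v) (by
      rintro _ _ ⟨r, x, k⟩
      obtain ⟨c, p, q, hp⟩ := LeftCalculus.ore v.den (r ≫ k)
      rw [actAux_eq v.num v.den _ _ p q hp,
        actAux_eq v.num v.den r x p (k ≫ q) (by simpa using hp), map_comp_apply])) (by
      rintro _ _ ⟨t, s, k⟩
      funext X
      induction X using Quot.ind with
      | mk X =>
      obtain ⟨c, p, q, hp⟩ := LeftCalculus.ore (s ≫ k) X.path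
      change actAux _ X = actAux _ X
      rw [actAux_eq (t ≫ k) _ X.path X.val p q hp,
        actAux_eq t s X.path X.val (k ≫ p) q (by simpa using hp), Category.assoc])

/-- The formula of the Jones action, for any `p`, `q` with `p s = q r`. -/
theorem act_mk {a b c : C} (t s : e ⟶ a) (r : e ⟶ b) (x : Φ.obj b)
    (p : a ⟶ c) (q : b ⟶ c) (hp : s ≫ p = r ≫ q) :
    act (.mk t s) (mk Φ r x) = mk Φ (t ≫ p) ((Φ.map q).hom x) :=
  actAux_eq t s r x p q hp

theorem act_mk_same {a : C} (t s : e ⟶ a) (x : Φ.obj a) :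
    act (.mk t s) (mk Φ s x) = mk Φ t x := by
  rw [act_mk t s s x (𝟙 a) (𝟙 a) rfl, map_id_apply, Category.comp_id]

theorem exists_common_den (v : FractionGroup e) (x : JonesLimit Φ e) :
    ∃ (a : C) (t s : e ⟶ a) (g : Φ.obj a), v = .mk t s ∧ x = mk Φ s g := by
  induction v using FractionGroup.ind with | h t s =>
  induction x using ind with | h r g =>
  obtain ⟨c, p, q, hpq⟩ := LeftCalculus.ore s r
  exact ⟨c, t ≫ p, s ≫ p, (Φ.map q).hom g, (FractionGroup.mk_comp _ _ _).symm,
    by rw [hpq, mk_comp]⟩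

theorem act_one (x : JonesLimit Φ e) : act 1 x = x := by
  induction x using ind with | h r x =>
  rw [← FractionGroup.mk_self r, act_mk_same]

theorem act_act (v w : FractionGroup e) (x : JonesLimit Φ e) :
    act (v * w) x = act v (act w x) := by
  obtain ⟨a, t, s, g, rfl, rfl⟩ := exists_common_den w x
  induction v using FractionGroup.ind with | h t' s' =>
  obtain ⟨c, p, q, hpq⟩ := LeftCalculus.ore s' t
  rw [FractionGroup.mk_mul_mk t' s' t s p q hpq, act_mk_same, act_mk t' s' t g p q hpq,
    ← mk_comp s g q, act_mk_same]

theorem act_mul (v : FractionGroup e) (x y : JonesLimit Φ e) :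
    act v (x * y) = act v x * act v y := by
  obtain ⟨a, r, g, h, rfl, rfl⟩ := exists_common x y
  induction v using FractionGroup.ind with | h t s =>
  obtain ⟨c, p, q, hp⟩ := LeftCalculus.ore s r
  rw [mk_mul_mk_same, act_mk t s r _ p q hp, act_mk t s r _ p q hp, act_mk t s r _ p q hp,
    mk_mul_mk_same, map_mul]

end JonesLimit

/-- The Jones action of the group of fractions on the limit group, by group automorphisms. -/
def jonesAction (Φ : C ⥤ GrpCat.{w}) (e : C) [LeftCalculus C] :
    FractionGroup e →* MulAut (JonesLimit Φ e) where
  toFun v :=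
    { toFun := JonesLimit.act v
      invFun := JonesLimit.act v⁻¹
      left_inv := fun x => by rw [← JonesLimit.act_act, inv_mul_cancel, JonesLimit.act_one]
      right_inv := fun x => by rw [← JonesLimit.act_act, mul_inv_cancel, JonesLimit.act_one]
      map_mul' := JonesLimit.act_mul v }
  map_one' := MulEquiv.ext JonesLimit.act_one
  map_mul' v w := MulEquiv.ext (JonesLimit.act_act v w)

end Limit
/-- Finite ordered rooted binary trees. -/
inductive BTree : Type
  | leaf : BTree
  | node : BTree → BTree → BTree

namespace BTree

/-- The leaves of a tree. -/
def Leaf : BTree → Type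
  | leaf => Unit
  | node l r => Leaf l ⊕ₗ Leaf r

/-- Leaves are ordered from left to right. -/
instance instLinearOrderLeaf : (t : BTree) → LinearOrder (Leaf t)
  | leaf => inferInstanceAs (LinearOrder Unit)
  | node l r =>
    have := instLinearOrderLeaf l
    have := instLinearOrderLeaf r
    inferInstanceAs (LinearOrder (Leaf l ⊕ₗ Leaf r))

instance instFintypeLeaf : (t : BTree) → Fintype (Leaf t)
  | leaf => inferInstanceAs (Fintype Unit)
  | node l r =>
    have := instFintypeLeaf l
    have := instFintypeLeaf r
    inferInstanceAs (Fintype (Lex (Leaf l ⊕ Leaf r)))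

instance : Unique (Leaf leaf) := inferInstanceAs (Unique Unit)

/-- The tree obtained from `t` by attaching the root of `f a` to each leaf `a` of `t`. -/
def graft : (t : BTree) → (Leaf t → BTree) → BTree
  | leaf, f => f ()
  | node l r, f => node (graft l fun a => f (toLex (Sum.inl a)))
      (graft r fun a => f (toLex (Sum.inr a)))

/-- The leaf of `graft t f` given by leaf `b` of the tree attached at leaf `a`. -/
def graftLeaf : (t : BTree) → (f : Leaf t → BTree) → (a : Leaf t) → Leaf (f a) → Leaf (graft t f)
  | leaf, _, (), b => b
  | node l _, f, Sum.inl a, b => toLex (Sum.inl (graftLeaf l (fun a => f (toLex (Sum.inl a))) a b))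
  | node _ r, f, Sum.inr a, b => toLex (Sum.inr (graftLeaf r (fun a => f (toLex (Sum.inr a))) a b))

theorem graftLeaf_surjective : (t : BTree) → (f : Leaf t → BTree) → (c : Leaf (graft t f)) →
    ∃ a b, graftLeaf t f a b = c
  | leaf, _, c => ⟨(), c, rfl⟩
  | node l r, f, c => by
    rcases c with c | c
    · obtain ⟨a, b, h⟩ := graftLeaf_surjective l _ c
      exact ⟨toLex (Sum.inl a), b, congrArg (fun x => toLex (Sum.inl x)) h⟩
    · obtain ⟨a, b, h⟩ := graftLeaf_surjective r _ c
      exact ⟨toLex (Sum.inr a), b, congrArg (fun x => toLex (Sum.inr x)) h⟩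

theorem graftLeaf_lt_left : (t : BTree) → (f : Leaf t → BTree) → (a a' : Leaf t) →
    (b : Leaf (f a)) → (b' : Leaf (f a')) → a < a' → graftLeaf t f a b < graftLeaf t f a' b'
  | leaf, _, a, a', _, _, h => absurd h (Subsingleton.elim (α := Unit) a a' ▸ lt_irrefl _)
  | node l r, f, Sum.inl a, Sum.inl a', b, b', h =>
    Sum.Lex.inl_lt_inl_iff.2 (graftLeaf_lt_left l (fun a => f (toLex (Sum.inl a))) a a' b b' (Sum.Lex.inl_lt_inl_iff.1 h))
  | node l r, f, Sum.inl a, Sum.inr a', b, b', h => Sum.Lex.inl_lt_inr _ _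
  | node l r, f, Sum.inr a, Sum.inl a', b, b', h => absurd h Sum.Lex.not_inr_lt_inl
  | node l r, f, Sum.inr a, Sum.inr a', b, b', h =>
    Sum.Lex.inr_lt_inr_iff.2 (graftLeaf_lt_left r (fun a => f (toLex (Sum.inr a))) a a' b b' (Sum.Lex.inr_lt_inr_iff.1 h))

theorem graftLeaf_lt_right : (t : BTree) → (f : Leaf t → BTree) → (a : Leaf t) →
    (b b' : Leaf (f a)) → b < b' → graftLeaf t f a b < graftLeaf t f a b'
  | leaf, _, (), _, _, h => h
  | node l _, f, Sum.inl a, b, b', h =>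
    Sum.Lex.inl_lt_inl_iff.2 (graftLeaf_lt_right l (fun a => f (toLex (Sum.inl a))) a b b' h)
  | node _ r, f, Sum.inr a, b, b', h =>
    Sum.Lex.inr_lt_inr_iff.2 (graftLeaf_lt_right r (fun a => f (toLex (Sum.inr a))) a b b' h)

theorem graft_leaf : (t : BTree) → graft t (fun _ => leaf) = t
  | leaf => rfl
  | node l r => congrArg₂ node (graft_leaf l) (graft_leaf r)

theorem graft_graft : (t : BTree) → (f : Leaf t → BTree) → (h : Leaf (graft t f) → BTree) →
    graft (graft t f) h = graft t fun a => graft (f a) fun b => h (graftLeaf t f a b)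
  | leaf, _, _ => rfl
  | node l r, f, h => congrArg₂ node
      (graft_graft l _ fun c => h (toLex (Sum.inl c))) (graft_graft r _ fun c => h (toLex (Sum.inr c)))

/-- Two trees have a common refinement. -/
theorem exists_graft_eq : (t s : BTree) → ∃ f g, graft t f = graft s g
  | leaf, s => ⟨fun _ => s, fun _ => leaf, (graft_leaf s).symm⟩
  | t, leaf => ⟨fun _ => leaf, fun _ => t, graft_leaf t⟩
  | node l r, node l' r' => by
    obtain ⟨f, f', hf⟩ := exists_graft_eq l l'
    obtain ⟨g, g', hg⟩ := exists_graft_eq r r'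
    exact ⟨fun a => Sum.elim f g (ofLex a), fun a => Sum.elim f' g' (ofLex a),
      congrArg₂ node hf hg⟩

theorem graft_injective : (t : BTree) → (f g : Leaf t → BTree) → graft t f = graft t g → f = g
  | leaf, f, g, h => funext fun _ => h
  | node l r, f, g, h => by
    have h' : node _ _ = node _ _ := h
    injection h' with h1 h2
    have e1 := graft_injective l _ _ h1
    have e2 := graft_injective r _ _ h2
    funext a
    rcases a with a | a
    · exact congrFun e1 a
    · exact congrFun e2 a

/-- The leaves of `graft t f` are the leaves of the attached trees. -/
def graftEquiv (t : BTree) (f : Leaf t → BTree) : (Σ a, Leaf (f a)) ≃ Leaf (graft t f) :=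
  Equiv.ofBijective (fun x => graftLeaf t f x.1 x.2) (by
    constructor
    · rintro ⟨a, b⟩ ⟨a', b'⟩ h
      rcases lt_trichotomy a a' with h' | rfl | h'
      · exact absurd h (graftLeaf_lt_left t f a a' b b' h').ne
      · rcases lt_trichotomy b b' with h' | rfl | h'
        · exact absurd h (graftLeaf_lt_right t f a b b' h').ne
        · rfl
        · exact absurd h (graftLeaf_lt_right t f a b' b h').ne'
      · exact absurd h (graftLeaf_lt_left t f a' a b' b h').ne'
    · intro c
      obtain ⟨a, b, h⟩ := graftLeaf_surjective t f c
      exact ⟨⟨a, b⟩, h⟩)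

end BTree

open BTree

/-- Forests with `n` roots and `m` leaves: `n` trees with `m` leaves in total. `Σₗ` is the
lexicographic order: leaves of a forest are ordered from left to right. -/
@[ext]
structure Forest (n m : ℕ) where
  trees : Fin n → BTree
  card_leaf : Fintype.card (Σₗ i, Leaf (trees i)) = m

namespace Forest

variable {n m k : ℕ}

/-- The numbering of the leaves of a forest from left to right. -/
def enum (f : Forest n m) : (Σₗ i, Leaf (f.trees i)) ≃o Fin m :=
  (monoEquivOfFin _ f.card_leaf).symm

/-- The number of leaf `a` of the `i`th tree. -/
def idx (f : Forest n m) (i : Fin n) (a : Leaf (f.trees i)) : Fin m := f.enum (toLex ⟨i, a⟩)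

theorem idx_lt_left (f : Forest n m) {i j : Fin n} (a : Leaf (f.trees i)) (b : Leaf (f.trees j))
    (h : i < j) : f.idx i a < f.idx j b :=
  f.enum.lt_iff_lt.2 (Sigma.Lex.left _ _ h)

theorem idx_lt_right (f : Forest n m) {i : Fin n} (a b : Leaf (f.trees i))
    (h : a < b) : f.idx i a < f.idx i b :=
  f.enum.lt_iff_lt.2 (Sigma.Lex.right _ _ h)

theorem idx_surjective (f : Forest n m) (j : Fin m) : ∃ i a, f.idx i a = j :=
  ⟨(ofLex (f.enum.symm j)).1, (ofLex (f.enum.symm j)).2, f.enum.apply_symm_apply j⟩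

theorem idx_unique (f : Forest n m) (φ : ∀ i, Leaf (f.trees i) → Fin m)
    (h1 : ∀ i j a b, i < j → φ i a < φ j b) (h2 : ∀ i a b, a < b → φ i a < φ i b) (i : Fin n)
    (a : Leaf (f.trees i)) : f.idx i a = φ i a := by
  let ψ : (Σₗ i, Leaf (f.trees i)) → Fin m := fun x => φ (ofLex x).1 (ofLex x).2
  have hψ : StrictMono ψ := by
    rintro ⟨i, a⟩ ⟨i', a'⟩ h
    rcases h with ⟨_, _, h⟩ | ⟨_, _, h⟩
    · exact h1 _ _ _ _ h
    · exact h2 _ _ _ h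
  have := congrFun (hψ.comp f.enum.symm.strictMono).eq_id (f.idx i a)
  have e : f.enum.symm (f.idx i a) = toLex ⟨i, a⟩ := f.enum.symm_apply_apply _
  rw [Function.comp_apply, e] at this
  exact this.symm

theorem idx_injective (f : Forest n m) {i j : Fin n} {a : Leaf (f.trees i)} {b : Leaf (f.trees j)}
    (h : f.idx i a = f.idx j b) : (⟨i, a⟩ : Σ i, Leaf (f.trees i)) = ⟨j, b⟩ :=
  toLex.injective (f.enum.injective h)

variable (n) in
/-- The trivial forest. -/
def id : Forest n n where
  trees _ := leaf
  card_leaf := by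
    have : Fintype.card (Σ _ : Fin n, Unit) = n := by simp
    exact this

theorem idx_id (i : Fin n) (a : Leaf leaf) : (id n).idx i a = i :=
  idx_unique (id n) (fun i _ => i) (fun _ _ _ _ h => h)
    (fun _ a b h => absurd h (by rw [Subsingleton.elim (α := Unit) a b]; exact lt_irrefl _)) i a

/-- The forest `g ∘ f` obtained by stacking `g` on top of `f`: the `j`th root of `g` is attached to
the `j`th leaf of `f`. -/
def comp (f : Forest n m) (g : Forest m k) : Forest n k where
  trees i := graft (f.trees i) fun a => g.trees (f.idx i a)
  card_leaf := by
    refine Eq.trans ?_ g.card_leaf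
    exact Fintype.card_congr
      ((Equiv.sigmaCongrRight fun i => (graftEquiv (f.trees i) _).symm).trans
        ((Equiv.sigmaAssoc fun i a => Leaf (g.trees (f.idx i a))).symm.trans
          (Equiv.sigmaCongrLeft (β := fun j => Leaf (g.trees j)) f.enum.toEquiv)))

theorem idx_comp (f : Forest n m) (g : Forest m k) (i : Fin n) (a : Leaf (f.trees i))
    (b : Leaf (g.trees (f.idx i a))) :
    (f.comp g).idx i (graftLeaf _ _ a b) = g.idx (f.idx i a) b := by
  have key := idx_unique (f.comp g)
    (fun i c => g.idx (f.idx i ((graftEquiv (f.trees i) _).symm c).1)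
      ((graftEquiv (f.trees i) _).symm c).2) ?_ ?_ i (graftLeaf _ _ a b)
  · rw [key]
    have e : (graftEquiv (f.trees i) fun a => g.trees (f.idx i a)).symm (graftLeaf _ _ a b)
        = ⟨a, b⟩ := (graftEquiv (f.trees i) fun a => g.trees (f.idx i a)).symm_apply_apply ⟨a, b⟩
    rw [e]
  · intro i j c d h
    exact idx_lt_left _ _ _ (idx_lt_left _ _ _ h)
  · intro i c d h
    obtain ⟨⟨a, b⟩, rfl⟩ := (graftEquiv (f.trees i) _).surjective c
    obtain ⟨⟨a', b'⟩, rfl⟩ := (graftEquiv (f.trees i) _).surjective d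
    rw [Equiv.symm_apply_apply, Equiv.symm_apply_apply]
    rcases lt_trichotomy a a' with h' | rfl | h'
    · exact idx_lt_left _ _ _ (idx_lt_right _ _ _ h')
    · refine idx_lt_right _ _ _ ?_
      rcases lt_trichotomy b b' with hb | rfl | hb
      · exact hb
      · exact absurd h (lt_irrefl _)
      · exact absurd h (lt_asymm
          (graftLeaf_lt_right (f.trees i) (fun a => g.trees (f.idx i a)) a b' b hb))
    · exact absurd h (lt_asymm
        (graftLeaf_lt_left (f.trees i) (fun a => g.trees (f.idx i a)) a' a b' b h'))

theorem id_comp (f : Forest n m) : (id n).comp f = f :=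
  Forest.ext (funext fun i => congrArg f.trees (idx_id i ()))

theorem comp_id (f : Forest n m) : f.comp (id m) = f :=
  Forest.ext (funext fun i => graft_leaf (f.trees i))

theorem comp_assoc {l : ℕ} (f : Forest n m) (g : Forest m k) (h : Forest k l) :
    (f.comp g).comp h = f.comp (g.comp h) := by
  refine Forest.ext (funext fun i => ?_)
  refine (graft_graft (f.trees i) _ _).trans ?_
  change _ = graft (f.trees i) fun a => graft (g.trees (f.idx i a)) _
  congr 1
  funext a
  congr 1
  funext b
  rw [idx_comp]

theorem ext_idx (f : Forest n m) {α : Type*} {x y : Fin m → α}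
    (h : ∀ i a, x (f.idx i a) = y (f.idx i a)) : x = y := by
  funext j
  obtain ⟨i, a, rfl⟩ := f.idx_surjective j
  exact h i a

/-- Any family of trees is a forest. -/
def ofTrees (t : Fin n → BTree) : Forest n (Fintype.card (Σₗ i, Leaf (t i))) := ⟨t, rfl⟩

/-- The forest `σ(f)` whose `i`th tree is the `σ i`th tree of `f`. -/
def permute (f : Forest n m) (σ : Equiv.Perm (Fin n)) : Forest n m where
  trees i := f.trees (σ i)
  card_leaf := by
    refine Eq.trans ?_ f.card_leaf
    exact Fintype.card_congr (Equiv.sigmaCongrLeft (β := fun j => Leaf (f.trees j)) σ)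

/-- Leaf `a` of the `i`th tree of `f.permute σ` is leaf `a` of the `σ i`th tree of `f`. -/
def permuteLeaves (f : Forest n m) (σ : Equiv.Perm (Fin n)) :
    (Σₗ i, Leaf ((f.permute σ).trees i)) ≃ Σₗ i, Leaf (f.trees i) :=
  ofLex.trans ((Equiv.sigmaCongrLeft (β := fun j => Leaf (f.trees j)) σ).trans toLex)

theorem permuteLeaves_apply (f : Forest n m) (σ : Equiv.Perm (Fin n)) (i : Fin n)
    (a : Leaf (f.trees (σ i))) :
    f.permuteLeaves σ (toLex ⟨i, a⟩) = toLex ⟨σ i, a⟩ := rfl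

/-- The permutation `S(f, σ)` obtained from `σ` by replacing the strand ending at `σ i` by as many
parallel strands as the `σ i`th tree of `f` has leaves. -/
def blockPerm (f : Forest n m) (σ : Equiv.Perm (Fin n)) : Equiv.Perm (Fin m) :=
  (f.permute σ).enum.symm.toEquiv.trans ((f.permuteLeaves σ).trans f.enum.toEquiv)

theorem blockPerm_idx (f : Forest n m) (σ : Equiv.Perm (Fin n)) (i : Fin n)
    (a : Leaf (f.trees (σ i))) : f.blockPerm σ ((f.permute σ).idx i a) = f.idx (σ i) a := by
  have e : (f.permute σ).enum.symm ((f.permute σ).idx i a) = toLex ⟨i, a⟩ :=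
    (f.permute σ).enum.symm_apply_apply _
  have h : f.blockPerm σ ((f.permute σ).idx i a) =
    f.enum (f.permuteLeaves σ ((f.permute σ).enum.symm ((f.permute σ).idx i a))) := rfl
  rw [h, e, permuteLeaves_apply]
  rfl

theorem idx_congr {f g : Forest n m} (h : f = g) (i : Fin n) (a : Leaf (f.trees i))
    (b : Leaf (g.trees i)) (hab : HEq a b) : f.idx i a = g.idx i b := by
  subst h; cases hab; rfl

theorem permute_one (f : Forest n m) : f.permute 1 = f := rfl

theorem permute_permute (f : Forest n m) (σ τ : Equiv.Perm (Fin n)) :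
    (f.permute σ).permute τ = f.permute (σ * τ) := rfl

theorem id_permute (σ : Equiv.Perm (Fin n)) : (id n).permute σ = id n := rfl

theorem perm_ext (f : Forest n m) {σ τ : Equiv.Perm (Fin m)}
    (h : ∀ i a, σ (f.idx i a) = τ (f.idx i a)) : σ = τ :=
  DFunLike.coe_injective (f.ext_idx h)

theorem blockPerm_one (f : Forest n m) : f.blockPerm 1 = 1 := by
  refine f.perm_ext fun i a => ?_
  rw [Equiv.Perm.one_apply]
  have h : (f.permute 1).idx i a = f.idx i a := idx_congr f.permute_one i a a HEq.rfl
  rw [← h]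
  exact f.blockPerm_idx 1 i a

theorem id_blockPerm (σ : Equiv.Perm (Fin n)) : (id n).blockPerm σ = σ :=
  (id n).perm_ext fun i a => by
    refine ((id n).blockPerm_idx σ i a).trans ?_
    exact (idx_id _ _).trans (congrArg σ (idx_id _ _)).symm

theorem blockPerm_mul (f : Forest n m) (σ τ : Equiv.Perm (Fin n)) :
    f.blockPerm (σ * τ) = f.blockPerm σ * (f.permute σ).blockPerm τ :=
  (f.permute (σ * τ)).perm_ext fun i a => by
    refine (f.blockPerm_idx (σ * τ) i a).trans ?_
    refine (blockPerm_idx f σ (τ i) a).symm.trans ?_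
    exact congrArg (f.blockPerm σ) ((f.permute σ).blockPerm_idx τ i a).symm

theorem comp_permute (f : Forest n m) (g : Forest m k) (σ : Equiv.Perm (Fin n)) :
    (f.comp g).permute σ = (f.permute σ).comp (g.permute (f.blockPerm σ)) := by
  refine Forest.ext (funext fun i => ?_)
  change graft (f.trees (σ i)) _ = graft (f.trees (σ i)) _
  congr 1
  funext a
  exact congrArg g.trees (f.blockPerm_idx σ i a).symm

theorem idx_congr_right (f : Forest n m) {i j : Fin n} (h : i = j) (a : Leaf (f.trees i))
    (b : Leaf (f.trees j)) (hab : HEq a b) : f.idx i a = f.idx j b := by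
  subst h; cases hab; rfl

theorem graftLeaf_heq {t : BTree} {F G : Leaf t → BTree} (h : F = G) (a : Leaf t)
    (b : Leaf (F a)) (c : Leaf (G a)) (hbc : HEq b c) :
    HEq (graftLeaf t F a b) (graftLeaf t G a c) := by
  subst h; cases hbc; rfl

theorem blockPerm_comp (f : Forest n m) (g : Forest m k) (σ : Equiv.Perm (Fin n)) :
    (f.comp g).blockPerm σ = g.blockPerm (f.blockPerm σ) :=
  ((f.permute σ).comp (g.permute (f.blockPerm σ))).perm_ext fun i c => by
    obtain ⟨a, b, rfl⟩ := graftLeaf_surjective _ _ c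
    have hx : f.blockPerm σ ((f.permute σ).idx i a) = f.idx (σ i) a := f.blockPerm_idx σ i a
    have hF : (fun a => (g.permute (f.blockPerm σ)).trees ((f.permute σ).idx i a)) =
        fun a => g.trees (f.idx (σ i) a) :=
      funext fun a => congrArg g.trees (f.blockPerm_idx σ i a)
    let b' : Leaf (g.trees (f.idx (σ i) a)) := cast (congrArg (fun F => Leaf (F a)) hF) b
    have hb : HEq b b' := (cast_heq _ _).symm
    have h1 := idx_congr (comp_permute f g σ).symm i _ _ (graftLeaf_heq hF a b b' hb)
    have h2 := blockPerm_idx (f.comp g) σ i (graftLeaf _ _ a b')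
    have h3 := idx_comp f g (σ i) a b'
    have h4 := blockPerm_idx g (f.blockPerm σ) ((f.permute σ).idx i a) b
    have h5 := idx_congr_right g hx b b' hb
    refine (congrArg _ h1).trans (h2.trans (h3.trans (h5.symm.trans (h4.symm.trans ?_))))
    exact congrArg _ (idx_comp _ _ i a b).symm


theorem leaf_nonempty : (t : BTree) → Nonempty (Leaf t)
  | leaf => ⟨()⟩
  | node l _ => ⟨toLex (Sum.inl (leaf_nonempty l).some)⟩

theorem pos_of_pos (f : Forest n m) (hn : 0 < n) : 0 < m :=
  Fin.pos (f.idx ⟨0, hn⟩ (leaf_nonempty _).some)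

theorem exists_refinement (p : Forest n m) (q : Forest n k) :
    ∃ (l : ℕ) (f : Forest m l) (g : Forest k l), p.comp f = q.comp g := by
  choose F G hFG using fun i => exists_graft_eq (p.trees i) (q.trees i)
  let f := ofTrees fun j : Fin m => F (ofLex (p.enum.symm j)).1 (ofLex (p.enum.symm j)).2
  let g := ofTrees fun j : Fin k => G (ofLex (q.enum.symm j)).1 (ofLex (q.enum.symm j)).2
  have hf : (p.comp f).trees = fun i => graft (p.trees i) (F i) := by
    funext i
    change graft _ _ = _
    congr 1
    funext a
    have e : p.enum.symm (p.idx i a) = toLex ⟨i, a⟩ := p.enum.symm_apply_apply _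
    change F (ofLex (p.enum.symm (p.idx i a))).1 (ofLex (p.enum.symm (p.idx i a))).2 = _
    rw [e]
    rfl
  have hg : (q.comp g).trees = fun i => graft (q.trees i) (G i) := by
    funext i
    change graft _ _ = _
    congr 1
    funext a
    have e : q.enum.symm (q.idx i a) = toLex ⟨i, a⟩ := q.enum.symm_apply_apply _
    change G (ofLex (q.enum.symm (q.idx i a))).1 (ofLex (q.enum.symm (q.idx i a))).2 = _
    rw [e]
    rfl
  have h : (p.comp f).trees = (q.comp g).trees := by
    rw [hf, hg]; exact funext hFG
  have hl := (p.comp f).card_leaf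
  rw [h] at hl
  have hl' := (q.comp g).card_leaf.symm.trans hl
  exact ⟨_, f, ⟨g.trees, g.card_leaf.trans hl'⟩, Forest.ext h⟩

theorem comp_left_cancel (f : Forest n m) (p q : Forest m k) (h : f.comp p = f.comp q) : p = q :=
  Forest.ext (f.ext_idx fun i a =>
    congrFun (graft_injective (f.trees i) _ _ (congrFun (congrArg Forest.trees h) i)) a)

variable {n' m' : ℕ}

/-- Horizontal concatenation, `f` to the left of `g`. -/
def tensor (f : Forest n m) (g : Forest n' m') : Forest (n + n') (m + m') where
  trees := Fin.append f.trees g.trees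
  card_leaf := by
    have hf : ∑ i, Fintype.card (Leaf (f.trees i)) = m := by
      rw [← Fintype.card_sigma]; exact f.card_leaf
    have hg : ∑ i, Fintype.card (Leaf (g.trees i)) = m' := by
      rw [← Fintype.card_sigma]; exact g.card_leaf
    have h : Fintype.card (Σ i, Leaf (Fin.append f.trees g.trees i)) = m + m' := by
      rw [Fintype.card_sigma, Fin.sum_univ_add]
      simp only [Fin.append_left, Fin.append_right, hf, hg]
    exact h

theorem tensor_trees_left (f : Forest n m) (g : Forest n' m') (i : Fin n) :
    (f.tensor g).trees (Fin.castAdd n' i) = f.trees i := Fin.append_left _ _ i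

theorem tensor_trees_right (f : Forest n m) (g : Forest n' m') (i : Fin n') :
    (f.tensor g).trees (Fin.natAdd n i) = g.trees i := Fin.append_right _ _ i

/-- The numbering of the leaves of `f.tensor g`. -/
def tensorIdx (f : Forest n m) (g : Forest n' m') (i : Fin (n + n')) :
    Leaf ((f.tensor g).trees i) → Fin (m + m') :=
  Fin.addCases (motive := fun i => Leaf ((f.tensor g).trees i) → Fin (m + m'))
    (fun i a => Fin.castAdd m' (f.idx i (cast (congrArg Leaf (f.tensor_trees_left g i)) a)))
    (fun i a => Fin.natAdd m (g.idx i (cast (congrArg Leaf (f.tensor_trees_right g i)) a))) i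

theorem tensorIdx_left (f : Forest n m) (g : Forest n' m') (i : Fin n) (a) :
    tensorIdx f g (Fin.castAdd n' i) a =
      Fin.castAdd m' (f.idx i (cast (congrArg Leaf (f.tensor_trees_left g i)) a)) := by
  unfold tensorIdx
  rw [Fin.addCases_left]

theorem tensorIdx_right (f : Forest n m) (g : Forest n' m') (i : Fin n') (a) :
    tensorIdx f g (Fin.natAdd n i) a =
      Fin.natAdd m (g.idx i (cast (congrArg Leaf (f.tensor_trees_right g i)) a)) := by
  unfold tensorIdx
  rw [Fin.addCases_right]

theorem castAdd_lt_natAdd {a b : ℕ} (i : Fin a) (j : Fin b) : Fin.castAdd b i < Fin.natAdd a j := by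
  rw [Fin.lt_def, Fin.val_castAdd, Fin.val_natAdd]
  omega

theorem cast_leaf_lt {t s : BTree} (h : t = s) {a b : Leaf t} (hab : a < b) :
    cast (congrArg Leaf h) a < cast (congrArg Leaf h) b := by
  subst h; exact hab

theorem idx_tensor (f : Forest n m) (g : Forest n' m') (i : Fin (n + n'))
    (a : Leaf ((f.tensor g).trees i)) : (f.tensor g).idx i a = tensorIdx f g i a := by
  refine idx_unique _ _ ?_ ?_ i a
  · intro i j a b h
    induction i using Fin.addCases with
    | left i =>
      induction j using Fin.addCases with
      | left j =>
        rw [tensorIdx_left, tensorIdx_left]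
        exact (Fin.strictMono_castAdd m') (idx_lt_left _ _ _ h)
      | right j =>
        rw [tensorIdx_left, tensorIdx_right]
        exact castAdd_lt_natAdd _ _
    | right i =>
      induction j using Fin.addCases with
      | left j => exact absurd h (lt_asymm (castAdd_lt_natAdd _ _))
      | right j =>
        rw [tensorIdx_right, tensorIdx_right]
        exact (Fin.strictMono_natAdd m) (idx_lt_left _ _ _ (by simpa using h))
  · intro i a b h
    induction i using Fin.addCases with
    | left i =>
      rw [tensorIdx_left, tensorIdx_left]
      exact (Fin.strictMono_castAdd m')
        (idx_lt_right _ _ _ (cast_leaf_lt (f.tensor_trees_left g i) h))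
    | right i =>
      rw [tensorIdx_right, tensorIdx_right]
      exact (Fin.strictMono_natAdd m)
        (idx_lt_right _ _ _ (cast_leaf_lt (f.tensor_trees_right g i) h))

/-- A tree as a forest with one root. -/
def single (t : BTree) : Forest 1 (Fintype.card (Σₗ _ : Fin 1, Leaf t)) := ofTrees fun _ => t

theorem exists_eq_tensor (f : Forest (n + 1) m) :
    ∃ (l : ℕ) (f₀ : Forest n l) (t : BTree) (h : l + Fintype.card (Σₗ _ : Fin 1, Leaf t) = m),
      f = ⟨(f₀.tensor (single t)).trees, (f₀.tensor (single t)).card_leaf.trans h⟩ := by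
  let f₀ := ofTrees fun i : Fin n => f.trees i.castSucc
  have e : f.trees = (f₀.tensor (single (f.trees (Fin.last n)))).trees := by
    change _ = Fin.append _ _
    rw [Fin.append_right_eq_snoc]
    exact (Fin.snoc_init_self f.trees).symm
  have h := (f₀.tensor (single (f.trees (Fin.last n)))).card_leaf
  rw [← e, f.card_leaf] at h
  exact ⟨_, f₀, _, h.symm, Forest.ext e⟩

end Forest

/-- A monoidal functor `Ξ` from forests to groups with `Ξ(1) = Γ`, hence `Ξ(n) = Γ^n`: groups carry
the direct product as tensor product and forests the horizontal concatenation. (The empty forest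
is included in the indexing as the unit of the concatenation; it carries no data.) -/
structure MonoidalForestFunctor (Γ : Type*) [Group Γ] where
  map : ∀ {n m : ℕ}, Forest n m → ((Fin n → Γ) →* (Fin m → Γ))
  map_id : ∀ n : ℕ, map (Forest.id n) = MonoidHom.id (Fin n → Γ)
  map_comp : ∀ {n m k : ℕ} (f : Forest n m) (g : Forest m k),
    map (f.comp g) = (map g).comp (map f)
  map_tensor : ∀ {n m n' m' : ℕ} (f : Forest n m) (g : Forest n' m')
    (x : Fin n → Γ) (y : Fin n' → Γ),
    map (f.tensor g) (Fin.append x y) = Fin.append (map f x) (map g y)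

section
variable {Γ : Type*} [Group Γ]

/-- `Tens(σ)(x₁, …, xₙ) = (x_{σ⁻¹(1)}, …, x_{σ⁻¹(n)})`. -/
def tens {n : ℕ} (σ : Equiv.Perm (Fin n)) : (Fin n → Γ) →* (Fin n → Γ) where
  toFun x i := x (σ⁻¹ i)
  map_one' := rfl
  map_mul' _ _ := rfl

theorem tens_apply {n : ℕ} (σ : Equiv.Perm (Fin n)) (x : Fin n → Γ) (i : Fin n) :
    tens σ x (σ i) = x i := congrArg x (σ.symm_apply_apply i)

theorem tens_mul {n : ℕ} (σ τ : Equiv.Perm (Fin n)) (x : Fin n → Γ) :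
    tens (σ * τ) x = tens σ (tens τ x) := by
  funext i
  change x ((σ * τ)⁻¹ i) = _
  rw [mul_inv_rev]
  rfl

theorem tens_one {n : ℕ} (x : Fin n → Γ) : tens 1 x = x := rfl

namespace MonoidalForestFunctor

variable (Ξ : MonoidalForestFunctor Γ)

theorem map_single_congr {t s : BTree} (h : t = s) {a : Leaf t} {b : Leaf s} (hab : HEq a b)
    (g : Γ) : Ξ.map (.single t) (fun _ => g) ((Forest.single t).idx 0 a) =
      Ξ.map (.single s) (fun _ => g) ((Forest.single s).idx 0 b) := by
  subst h; cases hab; rfl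

/-- `Ξ f` acts tree by tree. -/
theorem map_idx {n m : ℕ} (f : Forest n m) (x : Fin n → Γ) (i : Fin n) (a : Leaf (f.trees i)) :
    Ξ.map f x (f.idx i a) =
      Ξ.map (.single (f.trees i)) (fun _ => x i) ((Forest.single (f.trees i)).idx 0 a) := by
  induction n generalizing m with
  | zero => exact i.elim0
  | succ n ih =>
    obtain ⟨l, f₀, t, h, hf⟩ := f.exists_eq_tensor
    subst h
    obtain rfl : f = f₀.tensor (.single t) := hf
    have hx : x = Fin.append (fun i => x (Fin.castAdd 1 i)) fun i => x (Fin.natAdd n i) :=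
      (Fin.append_castAdd_natAdd (f := x)).symm
    rw [Forest.idx_tensor]
    induction i using Fin.addCases with
    | left i =>
      rw [Forest.tensorIdx_left, hx, Ξ.map_tensor, Fin.append_left, ih, Fin.append_left]
      exact Ξ.map_single_congr (f₀.tensor_trees_left _ i).symm (cast_heq _ _) _
    | right i =>
      rw [Forest.tensorIdx_right, hx, Ξ.map_tensor, Fin.append_right, Fin.append_right]
      obtain rfl : i = 0 := Subsingleton.elim _ _
      have e : (fun j : Fin 1 => x (Fin.natAdd n j)) = fun _ => x (Fin.natAdd n 0) :=
        funext fun j => by rw [Subsingleton.elim j 0]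
      rw [e]
      exact Ξ.map_single_congr (f₀.tensor_trees_right (Forest.single t) 0).symm (cast_heq _ _) _

theorem map_tens {n m : ℕ} (f : Forest n m) (σ : Equiv.Perm (Fin n)) (x : Fin n → Γ) :
    Ξ.map f (tens σ x) = tens (f.blockPerm σ) (Ξ.map (f.permute σ) x) := by
  refine f.ext_idx fun j a => ?_
  obtain ⟨i, rfl⟩ := σ.surjective j
  have h1 := f.blockPerm_idx σ i a
  rw [← h1, tens_apply, h1, Ξ.map_idx, tens_apply]
  exact (Ξ.map_idx (f.permute σ) x i a).symm

end MonoidalForestFunctor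
end

/-- The category of forests, with objects the positive integers. -/
structure ForestCat where
  rank : ℕ+

instance : Category ForestCat where
  Hom a b := Forest a.rank b.rank
  id a := Forest.id a.rank
  comp f g := f.comp g
  id_comp := Forest.id_comp
  comp_id := Forest.comp_id
  assoc := Forest.comp_assoc

instance : LeftCalculus ForestCat where
  ore {e a b} p q := by
    obtain ⟨l, f, g, h⟩ := Forest.exists_refinement p q
    exact ⟨⟨⟨l, f.pos_of_pos a.rank.pos⟩⟩, f, g, h⟩
  cancel f p q h := ⟨_, 𝟙 _, by rw [Forest.comp_left_cancel f p q h]⟩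

/-- Symmetric forests `σ ∘ p` with `n` roots and `m` leaves: a forest `p` and a permutation `σ` of
its leaves. -/
@[ext]
structure SymForest (n m : ℕ) where
  forest : Forest n m
  perm : Equiv.Perm (Fin m)

namespace SymForest

variable {n m k l : ℕ}

/-- The trivial symmetric forest. -/
def id (n : ℕ) : SymForest n n := ⟨.id n, 1⟩

/-- Composition of symmetric forests, `(τ ∘ q) ∘ (σ ∘ p) = (τ S(q, σ)) ∘ (σ(q) ∘ p)`. -/
def comp (φ : SymForest n m) (ψ : SymForest m k) : SymForest n k where
  forest := φ.forest.comp (ψ.forest.permute φ.perm)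
  perm := ψ.perm * ψ.forest.blockPerm φ.perm

theorem id_comp (φ : SymForest n m) : (id n).comp φ = φ :=
  SymForest.ext (φ.forest.id_comp)
    (by change φ.perm * φ.forest.blockPerm 1 = _; rw [Forest.blockPerm_one, mul_one])

theorem comp_id (φ : SymForest n m) : φ.comp (id m) = φ :=
  SymForest.ext (φ.forest.comp_id)
    (by change 1 * (Forest.id m).blockPerm φ.perm = _; rw [Forest.id_blockPerm, one_mul])

theorem comp_assoc (φ : SymForest n m) (ψ : SymForest m k) (χ : SymForest k l) :
    (φ.comp ψ).comp χ = φ.comp (ψ.comp χ) := by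
  refine SymForest.ext ?_ ?_
  · change (φ.forest.comp (ψ.forest.permute φ.perm)).comp
      (χ.forest.permute (ψ.perm * ψ.forest.blockPerm φ.perm)) =
      φ.forest.comp ((ψ.forest.comp (χ.forest.permute ψ.perm)).permute φ.perm)
    rw [Forest.comp_assoc, Forest.comp_permute, Forest.permute_permute]
  · change χ.perm * χ.forest.blockPerm (ψ.perm * ψ.forest.blockPerm φ.perm) =
      χ.perm * χ.forest.blockPerm ψ.perm *
        (ψ.forest.comp (χ.forest.permute ψ.perm)).blockPerm φ.perm
    rw [Forest.blockPerm_comp, Forest.blockPerm_mul, mul_assoc]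

/-- A forest as a symmetric forest. -/
def ofForest (f : Forest n m) : SymForest n m := ⟨f, 1⟩

/-- A permutation as a symmetric forest. -/
def ofPerm (σ : Equiv.Perm (Fin n)) : SymForest n n := ⟨.id n, σ⟩

theorem ofForest_comp (f : Forest n m) (g : Forest m k) :
    (ofForest f).comp (ofForest g) = ofForest (f.comp g) :=
  SymForest.ext rfl (by change 1 * g.blockPerm 1 = 1; rw [Forest.blockPerm_one, one_mul])

theorem comp_ofPerm (φ : SymForest n m) (σ : Equiv.Perm (Fin m)) :
    φ.comp (ofPerm σ) = ⟨φ.forest, σ * φ.perm⟩ :=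
  SymForest.ext (φ.forest.comp_id)
    (by change σ * (Forest.id m).blockPerm φ.perm = _; rw [Forest.id_blockPerm])

theorem comp_ofPerm_inv (φ : SymForest n m) : φ.comp (ofPerm φ.perm⁻¹) = ofForest φ.forest := by
  rw [comp_ofPerm, inv_mul_cancel]; rfl

end SymForest

/-- The category of symmetric forests, with objects the positive integers. -/
structure SymForestCat where
  rank : ℕ+

instance : Category SymForestCat where
  Hom a b := SymForest a.rank b.rank
  id a := SymForest.id a.rank
  comp f g := f.comp g
  id_comp := SymForest.id_comp
  comp_id := SymForest.comp_id
  assoc := SymForest.comp_assoc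

theorem Forest.permute_injective {n m : ℕ} (f g : Forest n m) (σ : Equiv.Perm (Fin n))
    (h : f.permute σ = g.permute σ) : f = g := by
  have := congrArg (fun F => F.permute σ⁻¹) h
  simp only [Forest.permute_permute, mul_inv_cancel] at this
  exact this

theorem SymForest.comp_left_cancel {n m k : ℕ} (φ : SymForest n m) (ψ χ : SymForest m k)
    (h : φ.comp ψ = φ.comp χ) : ψ = χ := by
  have h1 : ψ.forest = χ.forest := Forest.permute_injective _ _ φ.perm
    (Forest.comp_left_cancel φ.forest _ _ (congrArg SymForest.forest h))
  have h2 : ψ.perm * ψ.forest.blockPerm φ.perm = χ.perm * χ.forest.blockPerm φ.perm :=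
    congrArg SymForest.perm h
  rw [h1] at h2
  exact SymForest.ext h1 (mul_right_cancel h2)

theorem SymForest.exists_refinement {n m k : ℕ} (φ : SymForest n m) (ψ : SymForest n k) :
    ∃ (l : ℕ) (f : SymForest m l) (g : SymForest k l), φ.comp f = ψ.comp g := by
  obtain ⟨l, f, g, h⟩ := Forest.exists_refinement φ.forest ψ.forest
  refine ⟨l, (ofPerm φ.perm⁻¹).comp (ofForest f), (ofPerm ψ.perm⁻¹).comp (ofForest g), ?_⟩
  rw [← comp_assoc, ← comp_assoc, comp_ofPerm_inv, comp_ofPerm_inv, ofForest_comp, ofForest_comp, h]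

instance : LeftCalculus SymForestCat where
  ore {e a b} p q := by
    obtain ⟨l, f, g, h⟩ := SymForest.exists_refinement p q
    exact ⟨⟨⟨l, f.forest.pos_of_pos a.rank.pos⟩⟩, f, g, h⟩
  cancel f p q h := ⟨_, 𝟙 _, by rw [SymForest.comp_left_cancel f p q h]⟩

/-- Thompson's group `V`, as the group of fractions of the category of symmetric forests at the
object `1`: its elements are fractions of symmetric trees. -/
abbrev ThompsonV : Type := FractionGroup (⟨1⟩ : SymForestCat)

/-- The fraction `t / s` of two symmetric trees with the same number of leaves. -/
def ThompsonV.mk {n : ℕ+} (t s : SymForest 1 n) : ThompsonV :=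
  FractionGroup.mk (C := SymForestCat) (e := ⟨1⟩) (a := ⟨n⟩) t s


/-- Morphisms `g ∘ σ ∘ p` of `𝒞_Ξ`: a symmetric forest whose `m` leaves are labelled by elements
of `Γ`. -/
@[ext]
structure LabelledForest (Γ : Type u) (n m : ℕ) extends SymForest n m where
  label : Fin m → Γ

namespace LabelledForest

variable {Γ : Type u} [Group Γ] (Ξ : MonoidalForestFunctor Γ) {n m k l : ℕ}

variable (Γ) in
/-- The trivial labelled forest. -/
def id (n : ℕ) : LabelledForest Γ n n := ⟨.id n, 1⟩

/-- Composition, following `q ∘ g = Ξ(q)(g) ∘ q` and `τ ∘ g = Tens(τ)(g) ∘ τ`: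
`(h ∘ τ ∘ q) ∘ (g ∘ σ ∘ p) = (h Tens(τ)(Ξ(q)(g))) ∘ ((τ ∘ q) ∘ (σ ∘ p))`. -/
def comp (φ : LabelledForest Γ n m) (ψ : LabelledForest Γ m k) : LabelledForest Γ n k where
  toSymForest := φ.toSymForest.comp ψ.toSymForest
  label := ψ.label * tens ψ.perm (Ξ.map ψ.forest φ.label)

theorem id_comp (φ : LabelledForest Γ n m) : comp Ξ (id Γ n) φ = φ :=
  LabelledForest.ext (congrArg SymForest.forest φ.toSymForest.id_comp)
    (congrArg SymForest.perm φ.toSymForest.id_comp)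
    (by
      change φ.label * tens φ.perm (Ξ.map φ.forest 1) = φ.label
      rw [map_one, map_one, mul_one])

theorem comp_id (φ : LabelledForest Γ n m) : comp Ξ φ (id Γ m) = φ :=
  LabelledForest.ext (congrArg SymForest.forest φ.toSymForest.comp_id)
    (congrArg SymForest.perm φ.toSymForest.comp_id)
    (by
      change 1 * tens 1 (Ξ.map (Forest.id m) φ.label) = φ.label
      rw [Ξ.map_id, one_mul, tens_one]
      rfl)

theorem comp_assoc (φ : LabelledForest Γ n m) (ψ : LabelledForest Γ m k)
    (χ : LabelledForest Γ k l) : comp Ξ (comp Ξ φ ψ) χ = comp Ξ φ (comp Ξ ψ χ) := by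
  have h := SymForest.comp_assoc φ.toSymForest ψ.toSymForest χ.toSymForest
  refine LabelledForest.ext (congrArg SymForest.forest h) (congrArg SymForest.perm h) ?_
  change χ.label * tens χ.perm (Ξ.map χ.forest (ψ.label * tens ψ.perm (Ξ.map ψ.forest φ.label))) =
    χ.label * tens χ.perm (Ξ.map χ.forest ψ.label) *
      tens (χ.perm * χ.forest.blockPerm ψ.perm)
        (Ξ.map (ψ.forest.comp (χ.forest.permute ψ.perm)) φ.label)
  rw [map_mul, map_mul, Ξ.map_tens, tens_mul, Ξ.map_comp, mul_assoc]
  rfl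

end LabelledForest

/-- The category `𝒞_Ξ`, with objects the positive integers. -/
structure LabelledForestCat {Γ : Type u} [Group Γ] (Ξ : MonoidalForestFunctor Γ) where
  rank : ℕ+

instance {Γ : Type u} [Group Γ] (Ξ : MonoidalForestFunctor Γ) :
    Category.{u} (LabelledForestCat Ξ) where
  Hom a b := LabelledForest Γ a.rank b.rank
  id a := LabelledForest.id Γ a.rank
  comp f g := LabelledForest.comp Ξ f g
  id_comp := LabelledForest.id_comp Ξ
  comp_id := LabelledForest.comp_id Ξ
  assoc := LabelledForest.comp_assoc Ξ

namespace MonoidalForestFunctor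

variable {Γ : Type u} [Group Γ] (Ξ : MonoidalForestFunctor Γ)

/-- The functor `Ξ` on the category of forests. -/
def functor : ForestCat ⥤ GrpCat.{u} where
  obj a := GrpCat.of (Fin a.rank → Γ)
  map f := GrpCat.ofHom (Ξ.map f)
  map_id a := GrpCat.hom_ext (Ξ.map_id a.rank)
  map_comp f g := GrpCat.hom_ext (Ξ.map_comp f g)

/-- The extension of `Ξ` to symmetric forests, with `σ ↦ Tens(σ)`. -/
def symFunctor : SymForestCat ⥤ GrpCat.{u} where
  obj a := GrpCat.of (Fin a.rank → Γ)
  map φ := GrpCat.ofHom ((tens φ.perm).comp (Ξ.map φ.forest))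
  map_id a := GrpCat.hom_ext (Ξ.map_id a.rank)
  map_comp φ ψ := by
    refine GrpCat.hom_ext (MonoidHom.ext fun x => ?_)
    change tens (ψ.perm * ψ.forest.blockPerm φ.perm)
      (Ξ.map (φ.forest.comp (ψ.forest.permute φ.perm)) x) =
      tens ψ.perm (Ξ.map ψ.forest (tens φ.perm (Ξ.map φ.forest x)))
    rw [Ξ.map_tens, tens_mul, Ξ.map_comp]
    rfl

/-- The group `𝒢_Ξ`: the inductive limit, over all trees `t`, of the groups `Γ_t = Γ^n`
(`n` the number of leaves of `t`). -/
abbrev limitGroup : Type u := JonesLimit Ξ.functor ⟨1⟩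

/-- The fraction `t / x` for a tree `t` with `n` leaves and `x` in `Γ^n`. -/
def limitMk {n : ℕ+} (t : Forest 1 n) (x : Fin n → Γ) : Ξ.limitGroup :=
  JonesLimit.mk Ξ.functor (e := ⟨1⟩) (a := ⟨n⟩) t x

/-- The map `t / x ↦ t / x` from the limit over trees to the limit over symmetric trees. -/
def toSym : Ξ.limitGroup → JonesLimit Ξ.symFunctor ⟨1⟩ :=
  Quot.lift (fun X => JonesLimit.mk Ξ.symFunctor (e := ⟨1⟩) (a := ⟨X.target.rank⟩)
      (SymForest.ofForest X.path) X.val) (by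
    rintro _ _ ⟨t, x, f⟩
    rename_i a b
    have h := JonesLimit.mk_comp (Φ := Ξ.symFunctor) (e := ⟨1⟩) (a := ⟨a.rank⟩) (b := ⟨b.rank⟩)
      (SymForest.ofForest t) x (SymForest.ofForest f)
    refine h.symm.trans ?_
    change JonesLimit.mk Ξ.symFunctor (e := ⟨1⟩) (a := ⟨b.rank⟩)
      ((SymForest.ofForest t).comp (SymForest.ofForest f)) _ = _
    rw [SymForest.ofForest_comp]
    rfl)

theorem toSym_mk {a : ForestCat} (t : Forest 1 a.rank) (x : Fin a.rank → Γ) :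
    Ξ.toSym (JonesLimit.mk Ξ.functor (e := ⟨1⟩) (a := a) t x) =
      JonesLimit.mk Ξ.symFunctor (e := ⟨1⟩) (a := ⟨a.rank⟩) (SymForest.ofForest t) x := rfl

theorem mk_eq_mk_ofForest {n : ℕ+} (φ : SymForest 1 n) (x : Fin n → Γ) :
    JonesLimit.mk Ξ.symFunctor (e := ⟨1⟩) (a := ⟨n⟩) φ x =
      JonesLimit.mk Ξ.symFunctor (e := ⟨1⟩) (a := ⟨n⟩) (SymForest.ofForest φ.forest)
        (tens φ.perm⁻¹ x) := by
  have h := JonesLimit.mk_comp (Φ := Ξ.symFunctor) (e := ⟨1⟩) (a := ⟨n⟩) (b := ⟨n⟩) φ x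
    (SymForest.ofPerm φ.perm⁻¹)
  refine h.symm.trans ?_
  change JonesLimit.mk Ξ.symFunctor (e := ⟨1⟩) (a := ⟨n⟩) (φ.comp (SymForest.ofPerm φ.perm⁻¹))
    (tens φ.perm⁻¹ (Ξ.map (Forest.id n) x)) = _
  rw [SymForest.comp_ofPerm_inv, Ξ.map_id]
  rfl

theorem toSym_bijective : Function.Bijective Ξ.toSym := by
  constructor
  · intro x y h
    induction x using JonesLimit.ind with | h t x =>
    induction y using JonesLimit.ind with | h s y =>
    rename_i a b
    obtain ⟨c, p, q, h1, h2⟩ := (JonesLimit.mk_eq_iff (Φ := Ξ.symFunctor) (e := ⟨1⟩)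
      (a := ⟨a.rank⟩) (b := ⟨b.rank⟩) (SymForest.ofForest t) x (SymForest.ofForest s) y).1 h
    have h1' : (SymForest.ofForest t).comp p = (SymForest.ofForest s).comp q := h1
    have hf : Forest.comp t p.forest = Forest.comp s q.forest := congrArg SymForest.forest h1'
    have hp : p.perm * p.forest.blockPerm 1 = q.perm * q.forest.blockPerm 1 :=
      congrArg SymForest.perm h1'
    rw [Forest.blockPerm_one, Forest.blockPerm_one, mul_one, mul_one] at hp
    have h2' : tens p.perm (Ξ.map p.forest x) = tens q.perm (Ξ.map q.forest y) := h2
    rw [hp] at h2'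
    have h3 := congrArg (tens q.perm⁻¹) h2'
    rw [← tens_mul, ← tens_mul, inv_mul_cancel, tens_one, tens_one] at h3
    exact (JonesLimit.mk_eq_iff (Φ := Ξ.functor) (e := ⟨1⟩) t x s y).2
      ⟨⟨c.rank⟩, p.forest, q.forest, hf, h3⟩
  · intro y
    induction y using JonesLimit.ind with | h φ y =>
    rename_i a
    exact ⟨JonesLimit.mk Ξ.functor (e := ⟨1⟩) (a := ⟨a.rank⟩) φ.forest (tens φ.perm⁻¹ y),
      (Ξ.mk_eq_mk_ofForest φ y).symm⟩

/-- The inductive limit over trees is canonically the inductive limit over symmetric trees. -/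
def limitEquiv : Ξ.limitGroup ≃* JonesLimit Ξ.symFunctor ⟨1⟩ :=
  MulEquiv.ofBijective
    (MonoidHom.mk' Ξ.toSym (fun x y => by
      obtain ⟨a, t, g, h, rfl, rfl⟩ := JonesLimit.exists_common x y
      have e := JonesLimit.mk_mul_mk_same (Φ := Ξ.symFunctor) (e := ⟨1⟩) (a := ⟨a.rank⟩)
        (SymForest.ofForest t) g h
      rw [JonesLimit.mk_mul_mk_same]
      exact e.symm))
    Ξ.toSym_bijective

/-- The Jones action of Thompson's group `V` on `𝒢_Ξ` by group automorphisms: the Jones action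
of the extended functor, transported to `𝒢_Ξ`; see `thompsonAction_mk` for the formula. -/
def thompsonAction : ThompsonV →* MulAut Ξ.limitGroup :=
  (MulAut.congr Ξ.limitEquiv.symm).toMonoidHom.comp (jonesAction Ξ.symFunctor ⟨1⟩)

/-- The action is given on fractions by `(θt / σs) · (s / x) = t / Tens(θ⁻¹σ)x`. -/
theorem thompsonAction_mk {n : ℕ+} (t s : Forest 1 n) (θ σ : Equiv.Perm (Fin n)) (x : Fin n → Γ) :
    Ξ.thompsonAction (ThompsonV.mk ⟨t, θ⟩ ⟨s, σ⟩) (Ξ.limitMk s x) =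
      Ξ.limitMk t (tens (θ⁻¹ * σ) x) := by
  have h0 : Ξ.thompsonAction (ThompsonV.mk ⟨t, θ⟩ ⟨s, σ⟩) (Ξ.limitMk s x) =
      Ξ.limitEquiv.symm (JonesLimit.act (ThompsonV.mk ⟨t, θ⟩ ⟨s, σ⟩)
        (Ξ.limitEquiv (Ξ.limitMk s x))) := rfl
  rw [h0, MulEquiv.symm_apply_eq]
  have h1 := Ξ.mk_eq_mk_ofForest ⟨s, σ⟩ (tens σ x)
  have h2 := Ξ.mk_eq_mk_ofForest ⟨t, θ⟩ (tens σ x)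
  rw [← tens_mul, inv_mul_cancel, tens_one] at h1
  rw [← tens_mul] at h2
  have h3 := JonesLimit.act_mk_same (Φ := Ξ.symFunctor) (e := ⟨1⟩) (a := ⟨n⟩)
    (SymForest.mk t θ) (SymForest.mk s σ) (tens σ x)
  exact ((congrArg (JonesLimit.act _) h1).symm.trans h3).trans h2

/-- The labels obtained at the leaves of a tree by pushing a label at the root upwards through the
carets with `S`. -/
def treeMap (S : Γ →* Γ × Γ) : (t : BTree) → Γ →* (Leaf t → Γ)
  | leaf => MonoidHom.pi fun _ => MonoidHom.id Γ
  | node l r => MonoidHom.pi fun a => Sum.elim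
      (fun b => (Pi.evalMonoidHom _ b).comp ((treeMap S l).comp ((MonoidHom.fst Γ Γ).comp S)))
      (fun b => (Pi.evalMonoidHom _ b).comp ((treeMap S r).comp ((MonoidHom.snd Γ Γ).comp S)))
      (ofLex a)

theorem treeMap_graft (S : Γ →* Γ × Γ) : (t : BTree) → (f : Leaf t → BTree) → (g : Γ) →
    (a : Leaf t) → (b : Leaf (f a)) →
    treeMap S (graft t f) g (graftLeaf t f a b) = treeMap S (f a) (treeMap S t g a) b
  | leaf, _, _, _, _ => rfl
  | node l _, f, g, Sum.inl a, b => treeMap_graft S l (fun a => f (toLex (Sum.inl a))) _ a b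
  | node _ r, f, g, Sum.inr a, b => treeMap_graft S r (fun a => f (toLex (Sum.inr a))) _ a b

/-- `treeMap` applied to each tree of a forest. -/
def forestMap (S : Γ →* Γ × Γ) {n m : ℕ} (f : Forest n m) : (Fin n → Γ) →* (Fin m → Γ) :=
  MonoidHom.pi fun j => (Pi.evalMonoidHom _ (ofLex (f.enum.symm j)).2).comp
    ((treeMap S _).comp (Pi.evalMonoidHom _ (ofLex (f.enum.symm j)).1))

theorem forestMap_idx (S : Γ →* Γ × Γ) {n m : ℕ} (f : Forest n m) (x : Fin n → Γ) (i : Fin n)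
    (a : Leaf (f.trees i)) : forestMap S f x (f.idx i a) = treeMap S (f.trees i) (x i) a := by
  have e : f.enum.symm (f.idx i a) = toLex ⟨i, a⟩ := f.enum.symm_apply_apply _
  change treeMap S _ (x (ofLex (f.enum.symm (f.idx i a))).1) (ofLex (f.enum.symm (f.idx i a))).2 = _
  rw [e]
  rfl

theorem treeMap_cast (S : Γ →* Γ × Γ) {t s : BTree} (h : t = s) (g : Γ) (a : Leaf t) :
    treeMap S t g a = treeMap S s g (cast (congrArg Leaf h) a) := by
  subst h; rfl

/-- The monoidal functor with `Ξ(1) = Γ` and `Ξ(Y) = S`. -/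
def ofHom (S : Γ →* Γ × Γ) : MonoidalForestFunctor Γ where
  map := forestMap S
  map_id n := MonoidHom.ext fun x => (Forest.id n).ext_idx fun i a => by
    rw [forestMap_idx]
    exact (congrArg x (Forest.idx_id i a)).symm
  map_comp f g := MonoidHom.ext fun x => (f.comp g).ext_idx fun i c => by
    obtain ⟨a, b, rfl⟩ := graftLeaf_surjective _ _ c
    refine (forestMap_idx S (f.comp g) x i _).trans ((treeMap_graft S _ _ _ _ _).trans ?_)
    refine Eq.trans ?_
      (congrArg (forestMap S g (forestMap S f x)) (Forest.idx_comp f g i a b)).symm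
    rw [forestMap_idx, forestMap_idx]
  map_tensor f g x y := (f.tensor g).ext_idx fun i a => by
    rw [forestMap_idx, Forest.idx_tensor]
    induction i using Fin.addCases with
    | left i =>
      rw [Forest.tensorIdx_left, Fin.append_left, Fin.append_left, forestMap_idx]
      exact treeMap_cast S (f.tensor_trees_left g i) _ _
    | right i =>
      rw [Forest.tensorIdx_right, Fin.append_right, Fin.append_right, forestMap_idx]
      exact treeMap_cast S (f.tensor_trees_right g i) _ _

/-- The tree `Y` with two leaves. -/
def caret : Forest 1 2 := ⟨fun _ => node leaf leaf, rfl⟩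

theorem ofHom_caret (S : Γ →* Γ × Γ) (x : Fin 1 → Γ) :
    (ofHom S).map caret x = ![(S (x 0)).1, (S (x 0)).2] := by
  refine caret.ext_idx fun i a => ?_
  have hi : ∀ i a, caret.idx i a = Sum.elim (fun _ => 0) (fun _ => 1) (ofLex a) :=
    Forest.idx_unique _ _ (fun i j a b h => absurd h (by rw [Subsingleton.elim i j]; exact lt_irrefl _))
     (fun i a b h => by
      rcases a with ⟨⟩ | ⟨⟩ <;> rcases b with ⟨⟩ | ⟨⟩
      · exact absurd h (lt_irrefl _)
      · exact Fin.zero_lt_one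
      · exact absurd h Sum.Lex.not_inr_lt_inl
      · exact absurd h (lt_irrefl _))
  rw [hi]
  obtain rfl : i = 0 := Subsingleton.elim _ _
  have := forestMap_idx S caret x 0 a
  rw [hi] at this
  refine this.trans ?_
  rcases a with ⟨⟩ | ⟨⟩ <;> rfl

end MonoidalForestFunctor
end JonesForest

end

noncomputable section

namespace JonesForest
open CategoryTheory

universe v₁ u₁ u₂

/-! Write `Φ` for `Ξ.symFunctor`, the extension of `Ξ` to symmetric forests by `σ ↦ Tens(σ)`. A
morphism of `𝒞_Ξ` is a pair `x ∘ φ` of a symmetric forest and a label, and the two commutation rules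
merge into `(y ∘ ψ) ∘ (x ∘ φ) = (y · Φ(ψ)(x)) ∘ ψφ` (`label_comp`). From here on only this rule, the
calculus of fractions of symmetric forests and their cancellation law `SymForest.comp_left_cancel`
matter. Labels are invertible, so they obstruct neither the Ore condition nor cancellation, and
`𝒞_Ξ` inherits its calculus of fractions from the shapes.

For the group, multiplying both terms of a fraction by `g⁻¹` gives `(g ∘ t) / (h ∘ s) = t / (g⁻¹h ∘
s) = [t / (g⁻¹h ∘ t)] · [t / s]`. The second factor lies in the copy of `V` formed by the unlabelled
fractions. The first has equal shapes above and below; such fractions multiply by `[t / (x ∘ t)] ·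
[t / (y ∘ t)] = t / (xy ∘ t)`, as in the limit of the groups `Γ_t`, and conjugating `s / (x ∘ s)` by
`t / s` yields `t / (x ∘ t)`, which is the Jones action. This dictates the map `toSemidirect`,
sending `(g ∘ t) / (h ∘ s)` to `(t / g⁻¹h, t / s)`.

Bijectivity is a matter of common expansions. An element of the kernel has terms whose shapes agree
after one expansion and whose labels agree after another; an expansion dominating both makes the two
terms equal. Since `Φ` need not be injective on morphisms' labels, labels can become equal only
after expanding, which is exactly what the inductive limit records. Surjectivity comes from
expanding `r / x` and `t / s` until `r` and `t` coincide.

This produces the semidirect product over symmetric trees; `limitEquiv` replaces that limit by the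
one over trees, because each symmetric tree becomes a tree after composing with a permutation. -/

/-- Two fractions are equal exactly when they have a common expansion. -/
theorem FractionGroup.mk_eq_iff {C : Type u₁} [Category.{v₁} C] [LeftCalculus C] {e a b : C}
    (t s : e ⟶ a) (t' s' : e ⟶ b) :
    FractionGroup.mk t s = FractionGroup.mk t' s' ↔
      ∃ (c : C) (p : a ⟶ c) (q : b ⟶ c), t ≫ p = t' ≫ q ∧ s ≫ p = s' ≫ q := by
  constructor
  · intro h
    have key : ∀ X Y : PreFraction e, Relation.EqvGen PreFraction.Step X Y →
        ∃ (c : C) (p : X.target ⟶ c) (q : Y.target ⟶ c),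
          X.num ≫ p = Y.num ≫ q ∧ X.den ≫ p = Y.den ≫ q := by
      intro X Y hXY
      induction hXY with
      | rel X Y h =>
        obtain ⟨t, s, f⟩ := h
        exact ⟨_, f, 𝟙 _, by simp, by simp⟩
      | refl X => exact ⟨_, 𝟙 _, 𝟙 _, rfl, rfl⟩
      | symm X Y _ ih =>
        obtain ⟨c, p, q, h1, h2⟩ := ih
        exact ⟨c, q, p, h1.symm, h2.symm⟩
      | trans X Y Z _ _ ih1 ih2 =>
        obtain ⟨c, p, q, h1, h2⟩ := ih1
        obtain ⟨d, p', q', h1', h2'⟩ := ih2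
        -- The middle fraction `Y` carries two expansions, `q` and `p'`. The Ore condition
        -- reconciles them only after precomposition with `Y.num`; weak cancellation then removes
        -- `Y.num`, so that `q ≫ f ≫ k = p' ≫ g ≫ k` serves the denominator as well as the
        -- numerator.
        obtain ⟨m, f, g, hfg⟩ := LeftCalculus.ore (Y.num ≫ q) (Y.num ≫ p')
        obtain ⟨n, k, hk⟩ := LeftCalculus.cancel Y.num (q ≫ f) (p' ≫ g) (by simpa using hfg)
        refine ⟨n, p ≫ f ≫ k, q' ≫ g ≫ k, ?_, ?_⟩
        · rw [← Category.assoc, h1, ← Category.assoc Z.num, ← h1']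
          simpa using congrArg (Y.num ≫ ·) hk
        · rw [← Category.assoc, h2, ← Category.assoc Z.den, ← h2']
          simpa using congrArg (Y.den ≫ ·) hk
    exact key _ _ (Quot.eqvGen_exact h)
  · rintro ⟨c, p, q, h1, h2⟩
    rw [← mk_comp t s p, ← mk_comp t' s' q, h1, h2]

/-! ### Labelled forests as pairs of a shape and a label -/

namespace LabelledForestCat

variable {Γ : Type u₂} [Group Γ] {Ξ : MonoidalForestFunctor Γ}

/-- The number of roots or leaves, as an object of the category of symmetric forests. -/
def toSym (a : LabelledForestCat Ξ) : SymForestCat := ⟨a.rank⟩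

/-- The symmetric forest underlying a labelled forest. -/
def shape {a b : LabelledForestCat Ξ} (f : a ⟶ b) : a.toSym ⟶ b.toSym :=
  LabelledForest.toSymForest f

/-- The labels of the leaves. -/
def label {a b : LabelledForestCat Ξ} (f : a ⟶ b) : Ξ.symFunctor.obj b.toSym :=
  LabelledForest.label f

/-- The symmetric forest `f` with its leaves labelled by `x`. -/
def mkHom {a b : LabelledForestCat Ξ} (f : a.toSym ⟶ b.toSym) (x : Ξ.symFunctor.obj b.toSym) :
    a ⟶ b :=
  LabelledForest.mk f x

/-- Allows an object supplied by the Ore condition for symmetric forests to be used as the target of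
a labelled morphism built with `mkHom`. -/
theorem exists_toSym_eq (c : SymForestCat) : ∃ c' : LabelledForestCat Ξ, c'.toSym = c :=
  ⟨⟨c.rank⟩, rfl⟩

theorem hom_ext {a b : LabelledForestCat Ξ} {f g : a ⟶ b} (h : shape f = shape g)
    (h' : label f = label g) : f = g :=
  LabelledForest.ext (congrArg SymForest.forest h) (congrArg SymForest.perm h) h'

theorem shape_mkHom {a b : LabelledForestCat Ξ} (f : a.toSym ⟶ b.toSym)
    (x : Ξ.symFunctor.obj b.toSym) : shape (mkHom f x) = f := rfl

theorem label_mkHom {a b : LabelledForestCat Ξ} (f : a.toSym ⟶ b.toSym)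
    (x : Ξ.symFunctor.obj b.toSym) : label (mkHom f x) = x := rfl

/-- Both commutation rules of `𝒞_Ξ` in one formula: `symFunctor` already combines `Ξ` on forests
with `Tens` on permutations, so permutations need no separate treatment below. -/
theorem label_comp {a b c : LabelledForestCat Ξ} (f : a ⟶ b) (g : b ⟶ c) :
    label (f ≫ g) = label g * (Ξ.symFunctor.map (shape g)).hom (label f) := rfl

/-! ### Calculus of left fractions for `𝒞_Ξ` -/

instance : LeftCalculus (LabelledForestCat Ξ) where
  ore {e a b} p q := by
    obtain ⟨c, h, k, hk⟩ := LeftCalculus.ore (shape p) (shape q)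
    obtain ⟨c, rfl⟩ := exists_toSym_eq (Ξ := Ξ) c
    -- The labels are chosen to cancel those transported from `p` and `q`, so both composites have
    -- label `1` over the common shape.
    refine ⟨c, mkHom h ((Ξ.symFunctor.map h).hom (label p))⁻¹,
      mkHom k ((Ξ.symFunctor.map k).hom (label q))⁻¹, hom_ext hk ?_⟩
    rw [label_comp, label_comp, label_mkHom, label_mkHom, shape_mkHom, shape_mkHom]
    exact (inv_mul_cancel _).trans (inv_mul_cancel _).symm
  cancel f p q h := by
    -- Cancellation is strict: the shapes cancel among symmetric forests, after which both labels
    -- carry the same right factor `Φ(shape p)(label f)`, which cancels in the group. The identity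
    -- thus serves as the required `g`.
    have h1 : shape p = shape q :=
      SymForest.comp_left_cancel _ _ _ (congrArg shape h : shape f ≫ shape p = shape f ≫ shape q)
    have h2 := congrArg label h
    rw [label_comp, label_comp, h1] at h2
    exact ⟨_, 𝟙 _, by rw [hom_ext h1 (mul_right_cancel h2)]⟩

/-! ### The isomorphism with the semidirect product over symmetric trees -/

variable (Ξ)

/-- The class of `(g ∘ t) / (h ∘ s)` is sent to `(t / g⁻¹h, t / s)`. -/
def toSemidirectFun (e : LabelledForestCat Ξ) : FractionGroup e →
    JonesLimit Ξ.symFunctor e.toSym ⋊[jonesAction Ξ.symFunctor e.toSym] FractionGroup e.toSym :=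
  Quot.lift (fun X => ⟨JonesLimit.mk Ξ.symFunctor (shape X.num) ((label X.num)⁻¹ * label X.den),
      FractionGroup.mk (shape X.num) (shape X.den)⟩) (by
    rintro _ _ ⟨t, s, f⟩
    refine SemidirectProduct.ext ?_ (FractionGroup.mk_comp _ _ _).symm
    refine (JonesLimit.mk_comp _ _ (shape f)).symm.trans ?_
    change JonesLimit.mk _ (shape t ≫ shape f) _ = JonesLimit.mk _ (shape t ≫ shape f) _
    refine congrArg _ ?_
    change _ = (label (t ≫ f))⁻¹ * label (s ≫ f)
    -- The label `u` of `f` enters both terms as a left factor, and `(u · Φ(f)(g))⁻¹ (u · Φ(f)(h)) =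
    -- Φ(f)(g⁻¹h)`. This is why the invariant is `g⁻¹h` and not `gh⁻¹`.
    rw [label_comp, label_comp, map_mul, map_inv]
    group)

theorem toSemidirectFun_mk {e a : LabelledForestCat Ξ} (t s : e ⟶ a) :
    toSemidirectFun Ξ e (.mk t s) =
      ⟨JonesLimit.mk Ξ.symFunctor (shape t) ((label t)⁻¹ * label s), .mk (shape t) (shape s)⟩ :=
  rfl

/-- `toSemidirectFun` as a group homomorphism. -/
def toSemidirect (e : LabelledForestCat Ξ) : FractionGroup e →*
    JonesLimit Ξ.symFunctor e.toSym ⋊[jonesAction Ξ.symFunctor e.toSym] FractionGroup e.toSym :=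
  MonoidHom.mk' (toSemidirectFun Ξ e) fun x y => by
    induction x using FractionGroup.ind with | h t s =>
    induction y using FractionGroup.ind with | h t' s' =>
    obtain ⟨c, f, f', h⟩ := LeftCalculus.ore s t'
    rw [← FractionGroup.mk_comp t s f, ← FractionGroup.mk_comp t' s' f', ← h]
    -- After expansion the two fractions are `t / s` and `s / r`, with the same middle term, and the
    -- expansions can be forgotten.
    generalize t ≫ f = t, s ≫ f = s, s' ≫ f' = r
    rw [FractionGroup.mk_mul_mk_self, toSemidirectFun_mk, toSemidirectFun_mk, toSemidirectFun_mk]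
    refine SemidirectProduct.ext ?_ (FractionGroup.mk_mul_mk_self _ _ _).symm
    change _ = _ * JonesLimit.act (.mk (shape t) (shape s)) (.mk _ (shape s) _)
    -- The action of `t / s` only replaces `s` by `t` beneath the label. With `g`, `h`, `k` the
    -- labels of `t`, `s`, `r`, what remains is `g⁻¹k = (g⁻¹h)(h⁻¹k)`.
    rw [JonesLimit.act_mk_same, JonesLimit.mk_mul_mk_same]
    refine congrArg (JonesLimit.mk Ξ.symFunctor (shape t)) ?_
    group

/-- Triviality of the left component equalizes the labels of `t` and `s` after an expansion `p`, and
triviality of the right component equalizes their shapes after an expansion `p'`. An expansion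
beyond both equalizes `t` and `s` as labelled forests. -/
theorem toSemidirect_injective (e : LabelledForestCat Ξ) :
    Function.Injective (toSemidirect Ξ e) := by
  refine (injective_iff_map_eq_one _).2 fun x hx => ?_
  induction x using FractionGroup.ind with | h t s =>
  have hl : JonesLimit.mk Ξ.symFunctor (shape t) ((label t)⁻¹ * label s) = 1 :=
    congrArg SemidirectProduct.left hx
  have hr : FractionGroup.mk (shape t) (shape s) = 1 := congrArg SemidirectProduct.right hx
  rw [← JonesLimit.mk_one (shape t), JonesLimit.mk_eq_iff] at hl
  rw [← FractionGroup.mk_self (shape t), FractionGroup.mk_eq_iff] at hr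
  -- The compatibility of `p` with `q` is not needed: `q` is applied only to the label `1`.
  obtain ⟨c, p, q, -, hp⟩ := hl
  obtain ⟨d, p', q', h1, h2⟩ := hr
  rw [map_one, map_mul, map_inv, inv_mul_eq_one] at hp
  -- Both pairs have numerator `shape t`, so cancelling it in `h1` turns `h2` into `shape s ≫ p' =
  -- shape t ≫ p'`.
  obtain rfl : p' = q' := SymForest.comp_left_cancel _ _ _ h1
  obtain ⟨m, f, g, hfg⟩ := LeftCalculus.ore (shape t ≫ p) (shape t ≫ p')
  -- Cancelling `shape t` makes this an identity between the expansions themselves, so it can also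
  -- be applied after `shape s`.
  have hc : p ≫ f = p' ≫ g := SymForest.comp_left_cancel _ _ _
    (by simpa using hfg : shape t ≫ p ≫ f = shape t ≫ p' ≫ g)
  obtain ⟨m, rfl⟩ := exists_toSym_eq (Ξ := Ξ) m
  -- Any label would do here, since it multiplies both composites on the left.
  let r : _ ⟶ m := mkHom (p ≫ f) 1
  have key : t ≫ r = s ≫ r := by
    refine hom_ext ?_ ?_
    · change shape t ≫ p ≫ f = shape s ≫ p ≫ f
      rw [hc, ← Category.assoc, ← h2, Category.assoc]
    · change 1 * (Ξ.symFunctor.map (p ≫ f)).hom (label t) =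
        1 * (Ξ.symFunctor.map (p ≫ f)).hom (label s)
      rw [JonesLimit.map_comp_apply, JonesLimit.map_comp_apply, hp]
  rw [← FractionGroup.mk_comp t s r, key, FractionGroup.mk_self]

/-- Once `t` and `r` are expanded to a common shape, the numerator can be left unlabelled and the
whole limit component stored as the label of the denominator. -/
theorem toSemidirect_surjective (e : LabelledForestCat Ξ) :
    Function.Surjective (toSemidirect Ξ e) := by
  rintro ⟨x, v⟩
  induction x using JonesLimit.ind with | h r x =>
  induction v using FractionGroup.ind with | h t s =>
  obtain ⟨c, f, g, h⟩ := LeftCalculus.ore t r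
  obtain ⟨c, rfl⟩ := exists_toSym_eq (Ξ := Ξ) c
  refine ⟨FractionGroup.mk (mkHom (t ≫ f) 1)
    (mkHom (s ≫ f) ((Ξ.symFunctor.map g).hom x)), ?_⟩
  refine SemidirectProduct.ext ?_ (FractionGroup.mk_comp t s f)
  change JonesLimit.mk _ (t ≫ f) ((1 : Ξ.symFunctor.obj c.toSym)⁻¹ * (Ξ.symFunctor.map g).hom x) = _
  rw [inv_one, one_mul, h]
  exact JonesLimit.mk_comp _ _ _

/-- The group of fractions of `𝒞_Ξ` is the semidirect product for the Jones action of the group of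
fractions of symmetric forests. -/
def fractionGroupEquiv (e : LabelledForestCat Ξ) : FractionGroup e ≃*
    JonesLimit Ξ.symFunctor e.toSym ⋊[jonesAction Ξ.symFunctor e.toSym] FractionGroup e.toSym :=
  MulEquiv.ofBijective (toSemidirect Ξ e) ⟨toSemidirect_injective Ξ e, toSemidirect_surjective Ξ e⟩

end LabelledForestCat

/-! ### From symmetric trees back to trees -/

/-- The semidirect products of `V` with the limit over trees and over symmetric trees agree. -/
def MonoidalForestFunctor.semidirectEquiv {Γ : Type u₂} [Group Γ] (Ξ : MonoidalForestFunctor Γ) :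
    Ξ.limitGroup ⋊[Ξ.thompsonAction] ThompsonV ≃*
      JonesLimit Ξ.symFunctor ⟨1⟩ ⋊[jonesAction Ξ.symFunctor ⟨1⟩] ThompsonV :=
  SemidirectProduct.congr Ξ.limitEquiv (MulEquiv.refl ThompsonV) fun v =>
    -- Equivariance is automatic, as `thompsonAction` is by definition the Jones action conjugated
    -- by `limitEquiv`.
    MulEquiv.ext fun x => Ξ.limitEquiv.apply_symm_apply
      (jonesAction Ξ.symFunctor ⟨1⟩ v (Ξ.limitEquiv x))

end JonesForest

end

theorem mainTheorem8 {Γ : Type*} [Group Γ] (Ξ : JonesForest.MonoidalForestFunctor Γ) :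
    ∃ _ : JonesForest.LeftCalculus (JonesForest.LabelledForestCat Ξ),
      Nonempty (JonesForest.FractionGroup (⟨1⟩ : JonesForest.LabelledForestCat Ξ) ≃*
        Ξ.limitGroup ⋊[Ξ.thompsonAction] JonesForest.ThompsonV) := by
  -- The two equivalences compose because `toSym` sends the object `1` of `𝒞_Ξ` definitionally to
  -- the object `1` of symmetric forests, whose group of fractions is `V`.
  exact ⟨inferInstance,
    ⟨(JonesForest.LabelledForestCat.fractionGroupEquiv Ξ ⟨1⟩).trans Ξ.semidirectEquiv.symm⟩⟩
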